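/- **Setting.** Let $\alpha>0$. For a modulus $k\in(0,1)$ let $\mathbf K(k),\mathbf E(k)$ be the complete elliptic integrals of the first and second kind, $\mathrm{sn},\mathrm{cn},\mathrm{dn}$ the Jacobi elliptic functions, and $\mathbf Z(u,k)=\int_0^u\mathrm{dn}^2(v,k)\,dv-\frac{\mathbf E(k)}{\mathbf K(k)}u$ the Jacobi zeta function. The action $I=\frac{8}{\pi}\sqrt\alpha\,[(k^2-1)\mathbf K(k)+\mathbf E(k)]$ is a strictly increasing function of $k\in(0,1)$; write $k=k(I)$ for its inverse, $\Omega(I)=\frac{\pi\sqrt\alpha}{2\mathbf K(k(I))}$ and $\zeta=\partial\Omega/\partial I$. In the variables $x=2\arcsin[k\,\mathrm{sn}(\frac{2\mathbf K(k)}{\pi}\varphi,k)]$, $y=2k\sqrt\alpha\,\mathrm{cn}(\frac{2\mathbf K(k)}{\pi}\varphi,k)$, the pendulum $x'=y$, $y'=-(\alpha-\varepsilon\cos(\tau-\tau_0))\sin x-C_1\varepsilon y$ inside the separatrix (that is, with $\beta=\varepsilon$ and $\gamma=C_1\varepsilon$) becomes $\varphi'=\Omega(I)+\varepsilon A(\varphi,I,\tau)$,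 $I'=\varepsilon B(\varphi,I,\tau)$, where, with $k=k(I)$ and all elliptic functions evaluated at $(\frac{2\mathbf K(k)}{\pi}\varphi,k)$, $$A=-\frac{\pi}{2\mathbf K(k)\sqrt\alpha}\Bigl[\mathrm{sn}^2+\frac{k^2\mathrm{sn}^2\mathrm{cn}^2}{1-k^2}-\frac{\mathbf Z\,\mathrm{sn}\,\mathrm{cn}\,\mathrm{dn}}{1-k^2}\Bigr]\cos(\tau-\tau_0)+\frac{C_1\pi\,\mathrm{cn}}{2\mathbf K(k)}\Bigl[\frac{\mathrm{sn}}{\mathrm{dn}}+\frac{k^2\mathrm{sn}\,\mathrm{cn}^2}{(1-k^2)\mathrm{dn}}-\frac{\mathbf Z\,\mathrm{cn}}{1-k^2}\Bigr],$$ $$B=\frac{8k^2\mathbf K(k)}{\pi}\cos(\tau-\tau_0)\,\mathrm{sn}\,\mathrm{cn}\,\mathrm{dn}-\frac{8C_1k^2\sqrt\alpha\,\mathbf K(k)}{\pi}\,\mathrm{cn}^2 .$$ Fix positive integers $p,q$ and $k_1\in(0,1)$ with $T:=2\pi q=4\mathbf K(k_1)p/\sqrt\alpha$ (a $p{:}q$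 resonance), let $I^{(0)}$ be the action at $k_1$, and $\zeta^{(0)}=\zeta(I^{(0)})$. Consider formal series $\varphi=\sum_{n\ge0}\varepsilon^n\varphi^{(n)}(\tau)$, $I=\sum_{n\ge0}\varepsilon^nI^{(n)}(\tau)$ with $\varphi^{(0)}(\tau)=\Omega(I^{(0)})\tau$ and constant $I^{(0)}$. Writing $[\,\cdot\,]^{(n)}$ for the coefficient of $\varepsilon^n$, they are a formal solution with initial conditions $(\bar\varphi^{(n)},\bar I^{(n)})_{n\ge1}$ if for all $n\ge1$ $$(\varphi^{(n)})'=\zeta^{(0)}I^{(n)}+F_1^{(n)},\quad (I^{(n)})'=F_2^{(n)},\quad \varphi^{(n)}(0)=\bar\varphi^{(n)},\quad I^{(n)}(0)=\bar I^{(n)},$$ $$F_1^{(n)}=[\Omega(I)-\zeta^{(0)}I]^{(n)}+[A(\varphi,I,\tau)]^{(n-1)},\qquad F_2^{(n)}=[B(\varphi,I,\tau)]^{(n-1)}.$$ Let $\langle g\rangle=\frac1T\int_0^Tg\,d\tau$; here $F_2^{(1)}$ depends only on $\varphi^{(0)},I^{(0)}$, $\tau_0$ and $C_1$. Put $$\Delta=\frac{\sqrt\alpha}{4\mathbf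 K(k_1)}\int_0^{4\mathbf K(k_1)/\sqrt\alpha}\mathrm{cn}^2(\sqrt\alpha\tau,k_1)\,d\tau,\qquad G_1=\frac1T\int_0^T\mathrm{sn}(\sqrt\alpha\tau,k_1)\,\mathrm{cn}(\sqrt\alpha\tau,k_1)\,\mathrm{dn}(\sqrt\alpha\tau,k_1)\sin\tau\,d\tau,\qquad C_1(p/q)=\frac{G_1}{\sqrt\alpha\,\Delta}.$$ **Lemma 1.** (a) Suppose $p/q=1/2m$ for some integer $m\ge1$. Then $C_1(p/q)>0$. For real $C_1$, there is a $\tau_0\in\mathbb R$ with $\langle F_2^{(1)}\rangle=0$ if and only if $|C_1|\le C_1(p/q)$; thus the first-order threshold is $\gamma=C_1(p/q)\,\varepsilon$. If $|C_1|<C_1(p/q)$, then $\tau_0$ and the initial conditions $(\bar\varphi^{(n)},\bar I^{(n)})_{n\ge1}$ can be fixed in such a way that the formal solution satisfies $\langle F_2^{(n)}\rangle=0$ for all $n\ge1$, and $\varphi^{(n)}$, $I^{(n)}$ are $T$-periodic for all $n\ge1$. (b) If $p/q\ne1/2m$ for all integers $m\ge1$, then $\langle F_2^{(1)}\rangle=0$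 for some $\tau_0$ only if $C_1=0$; in particular, the condition $\langle F_2^{(n)}\rangle=0$ for all $n\ge1$ can be satisfied only if $C_1=0$. -/

import Mathlib

noncomputable section

namespace Pendulum

/-! ### Elliptic integrals and Jacobi elliptic functions of modulus `k`, `0 < k < 1` -/

/-- Incomplete elliptic integral of the first kind, as a function of the amplitude `θ`. -/
def incompleteF (k θ : ℝ) : ℝ :=
  ∫ ψ in (0 : ℝ)..θ, 1 / Real.sqrt (1 - k ^ 2 * Real.sin ψ ^ 2)

/-- Complete elliptic integral of the first kind. -/
def ellipticK (k : ℝ) : ℝ :=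
  ∫ ψ in (0 : ℝ)..(Real.pi / 2), 1 / Real.sqrt (1 - k ^ 2 * Real.sin ψ ^ 2)

/-- Complete elliptic integral of the second kind. -/
def ellipticE (k : ℝ) : ℝ :=
  ∫ ψ in (0 : ℝ)..(Real.pi / 2), Real.sqrt (1 - k ^ 2 * Real.sin ψ ^ 2)

/-- Jacobi amplitude: the inverse of the increasing bijection `θ ↦ incompleteF k θ` of `ℝ`. -/
def am (u k : ℝ) : ℝ := Function.invFun (incompleteF k) u

def sn (u k : ℝ) : ℝ := Real.sin (am u k)

def cn (u k : ℝ) : ℝ := Real.cos (am u k)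

def dn (u k : ℝ) : ℝ := Real.sqrt (1 - k ^ 2 * sn u k ^ 2)

/-- Incomplete elliptic integral of the second kind `E(u, k) = ∫₀ᵘ dn²(v, k) dv`. -/
def incompleteE (u k : ℝ) : ℝ := ∫ v in (0 : ℝ)..u, dn v k ^ 2

/-- Jacobi zeta function, `E(u, k) = E(k) u / K(k) + Z(u, k)`. -/
def zetaJ (u k : ℝ) : ℝ := incompleteE u k - ellipticE k * u / ellipticK k

/-! ### Action-angle variables for the librations of `θ'' + α sin θ = 0` -/

/-- The action of the libration with modulus `k`. -/
def action (α k : ℝ) : ℝ :=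
  8 / Real.pi * Real.sqrt α * ((k ^ 2 - 1) * ellipticK k + ellipticE k)

/-- The modulus `k ∈ (0, 1)` as a function of the action (the map `k ↦ action α k` is strictly
increasing on `(0, 1)`). -/
def modulus (α I : ℝ) : ℝ := Function.invFunOn (action α) (Set.Ioo 0 1) I

/-- The unperturbed frequency `Ω(I)`. -/
def freq (α I : ℝ) : ℝ := Real.pi * Real.sqrt α / (2 * ellipticK (modulus α I))

/-- `ζ(I) = ∂Ω/∂I`. -/
def freqDeriv (α I : ℝ) : ℝ := deriv (freq α) I

/-! ### The perturbed system
`φ' = Ω(I) + ε * angleField`, `I' = ε * actionField`, which is the system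
`x' = y`, `y' = -(α - ε cos (τ - τ₀)) sin x - C₁ ε y` in the action-angle variables
`x = 2 arcsin (k sn (2 K(k) φ / π, k))`, `y = 2 k √α cn (2 K(k) φ / π, k)`. -/

/-- The coefficient of `ε` in the equation for the angle `φ`. -/
def angleField (α C₁ τ₀ τ φ I : ℝ) : ℝ :=
  let k := modulus α I
  let u := 2 * ellipticK k / Real.pi * φ
  (-(Real.pi / (2 * ellipticK k * Real.sqrt α))) *
      (sn u k ^ 2 + k ^ 2 * sn u k ^ 2 * cn u k ^ 2 / (1 - k ^ 2)
        - zetaJ u k * sn u k * cn u k * dn u k / (1 - k ^ 2)) * Real.cos (τ - τ₀)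
    + C₁ * Real.pi * cn u k / (2 * ellipticK k) *
      (sn u k / dn u k + k ^ 2 * sn u k * cn u k ^ 2 / ((1 - k ^ 2) * dn u k)
        - zetaJ u k * cn u k / (1 - k ^ 2))

/-- The coefficient of `ε` in the equation for the action `I`. -/
def actionField (α C₁ τ₀ τ φ I : ℝ) : ℝ :=
  let k := modulus α I
  let u := 2 * ellipticK k / Real.pi * φ
  8 * k ^ 2 * ellipticK k / Real.pi * Real.cos (τ - τ₀) * sn u k * cn u k * dn u k
    - 8 * C₁ * k ^ 2 * Real.sqrt α * ellipticK k / Real.pi * cn u k ^ 2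

/-! ### Formal power series in `ε` -/

/-- `[g(φ, I)]⁽ⁿ⁾`: the coefficient of `εⁿ` of `g (∑ⱼ εʲ φⱼ) (∑ⱼ εʲ Iⱼ)`. It only involves the
coefficients with `j ≤ n`, so the series are truncated there. -/
def orderCoeff (n : ℕ) (g : ℝ → ℝ → ℝ) (φ I : ℕ → ℝ) : ℝ :=
  iteratedDeriv n
    (fun ε : ℝ => g (∑ j ∈ Finset.range (n + 1), ε ^ j * φ j)
      (∑ j ∈ Finset.range (n + 1), ε ^ j * I j)) 0 / (n.factorial : ℝ)

/-- `F₁⁽ⁿ⁾(τ)`, `n ≥ 1`, for the expansion around the unperturbed libration of modulus `k`. -/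
def F₁ (α C₁ τ₀ k : ℝ) (φ I : ℕ → ℝ → ℝ) (n : ℕ) (τ : ℝ) : ℝ :=
  orderCoeff n (fun _ J => freq α J - freqDeriv α (action α k) * J)
      (fun j => φ j τ) (fun j => I j τ)
    + orderCoeff (n - 1) (angleField α C₁ τ₀ τ) (fun j => φ j τ) (fun j => I j τ)

/-- `F₂⁽ⁿ⁾(τ)`, `n ≥ 1`. -/
def F₂ (α C₁ τ₀ : ℝ) (φ I : ℕ → ℝ → ℝ) (n : ℕ) (τ : ℝ) : ℝ :=
  orderCoeff (n - 1) (actionField α C₁ τ₀ τ) (fun j => φ j τ) (fun j => I j τ)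

/-- The zeroth order of the series is the unperturbed libration of modulus `k`. -/
def IsUnperturbed (α k : ℝ) (φ I : ℕ → ℝ → ℝ) : Prop :=
  (∀ τ, φ 0 τ = freq α (action α k) * τ) ∧ (∀ τ, I 0 τ = action α k)

/-- The coefficients `φ⁽ⁿ⁾`, `I⁽ⁿ⁾` solve the equations of motion order by order, starting from
the unperturbed libration of modulus `k`, with initial conditions
`φ⁽ⁿ⁾(0) = φbar n`, `I⁽ⁿ⁾(0) = Ibar n` for `n ≥ 1`. -/
structure IsFormalSolution (α C₁ τ₀ k : ℝ) (φbar Ibar : ℕ → ℝ) (φ I : ℕ → ℝ → ℝ) : Prop where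
  unperturbed : IsUnperturbed α k φ I
  angle_init : ∀ n, 1 ≤ n → φ n 0 = φbar n
  action_init : ∀ n, 1 ≤ n → I n 0 = Ibar n
  angle_eq : ∀ n, 1 ≤ n → ∀ τ,
    HasDerivAt (φ n) (freqDeriv α (action α k) * I n τ + F₁ α C₁ τ₀ k φ I n τ) τ
  action_eq : ∀ n, 1 ≤ n → ∀ τ, HasDerivAt (I n) (F₂ α C₁ τ₀ φ I n τ) τ

/-- The average `⟨g⟩` over `[0, T]`. -/
def average (T : ℝ) (g : ℝ → ℝ) : ℝ := 1 / T * ∫ τ in (0 : ℝ)..T, g τ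

/-! ### The threshold constant -/

/-- `Δ`: the average of `cn²(√α τ, k)` over the period of `τ ↦ cn(√α τ, k)`. -/
def Delta (α k : ℝ) : ℝ :=
  average (4 * ellipticK k / Real.sqrt α) (fun τ => cn (Real.sqrt α * τ) k ^ 2)

/-- `G₁`: the average of `sn cn dn (√α τ, k) sin τ` over the period `T`. -/
def G₁ (α k T : ℝ) : ℝ :=
  average T (fun τ => sn (Real.sqrt α * τ) k * cn (Real.sqrt α * τ) k
    * dn (Real.sqrt α * τ) k * Real.sin τ)

/-- The threshold constant `C₁(p/q) = G₁ / (√α Δ)`. -/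
def threshold (α k T : ℝ) : ℝ := G₁ α k T / (Real.sqrt α * Delta α k)

end Pendulum

end

/-! Periodic formal solutions near a resonance of the parametrically forced damped pendulum. -/

noncomputable section
open Set Filter Topology MeasureTheory Asymptotics
open scoped ContDiff

namespace Pendulum

/-! ### Integrals over a fixed interval depending smoothly on a parameter. -/

section Parametric

/-! Along the unperturbed orbit the elliptic argument is `√α τ`. Since `sn cn dn` is odd, only the
sine part of the forcing survives averaging, and `⟨F₂⁽¹⁾⟩` is a positive multiple of `sin τ₀ G₁ - C₁
√α Δ` (`average_F₂_one`). Hence it vanishes exactly when `C₁ = sin τ₀ * threshold`, and the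
first-order claims reduce to the sign of `G₁`.

The function `sn cn dn (√α τ)` has period `P = 2K/√α`. Shifting by `P` gives `(1 - cos P) G₁ = 0`,
so `G₁ = 0` unless `P = 2πm`, that is `p/q = 1/2m` (`G₁_eq_zero`). When `P = 2πm`, integration by
parts turns `G₁` into a positive multiple of the `m`-th cosine coefficient of `dn²` (`G₁_pos`).

That coefficient is positive (`dnCoeff_pos`) without any explicit Fourier series. The ascending
Landen transformation multiplies it by a positive factor while doubling the index
(`dnCoeff_landen`). Under iteration the modulus tends to 1 and the frequency, written in the
amplitude variable, converges. The integrals then tend to `∫ cos θ cos(ν gd⁻¹ θ) dθ`, a Beta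
integral equal to `2|Γ(1 + iν/2)|² > 0`. Positivity far along the sequence pulls back to its start.

At higher orders each equation is solved by a primitive, and its two free constants restore
solvability. The constant in `I⁽ⁿ⁾` makes the angle equation mean-free, because `ζ⁽⁰⁾ ≠ 0`
(`freqDeriv_ne_zero`). The constant in `φ⁽ⁿ⁾` enters `F₂⁽ⁿ⁺¹⁾` linearly through `∂B/∂φ`, whose mean
is a nonzero multiple of `cos τ₀ G₁`. This is nonzero when `|C₁|` lies strictly below the threshold,
so `⟨F₂⁽ⁿ⁺¹⁾⟩ = 0` can be arranged (`exists_succ`). -/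

theorem exists_ball_bound {E : Type} [NormedAddCommGroup E] [ProperSpace E]
    {F : Type} [NormedAddCommGroup F] {V : Set E} (hV : IsOpen V)
    {g : E × ℝ → F} (hg : ContinuousOn g (V ×ˢ univ)) (a b : ℝ) {x₀ : E} (hx₀ : x₀ ∈ V) :
    ∃ r > 0, ∃ C : ℝ, Metric.ball x₀ r ⊆ V ∧
      ∀ x ∈ Metric.ball x₀ r, ∀ s ∈ uIcc a b, ‖g (x, s)‖ ≤ C := by
  obtain ⟨r, hr, hrV⟩ := Metric.nhds_basis_closedBall.mem_iff.1 (hV.mem_nhds hx₀)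
  have hc : IsCompact (Metric.closedBall x₀ r ×ˢ uIcc a b) :=
    (isCompact_closedBall x₀ r).prod isCompact_uIcc
  obtain ⟨C, hC⟩ := hc.exists_bound_of_continuousOn
    (hg.mono (prod_mono hrV (subset_univ _)))
  exact ⟨r, hr, C, Metric.ball_subset_closedBall.trans hrV,
    fun x hx s hs => hC _ ⟨Metric.ball_subset_closedBall hx, hs⟩⟩

theorem continuous_section {E : Type} [NormedAddCommGroup E] {F : Type} [NormedAddCommGroup F] {V : Set E}
    {g : E × ℝ → F} (hg : ContinuousOn g (V ×ˢ univ)) {x : E} (hx : x ∈ V) :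
    Continuous fun s => g (x, s) := by
  rw [← continuousOn_univ]
  exact hg.comp (by fun_prop) (fun s _ => ⟨hx, mem_univ _⟩)

theorem continuousOn_intervalIntegral_param {E : Type} [NormedAddCommGroup E] [ProperSpace E]
    {F : Type} [NormedAddCommGroup F] [NormedSpace ℝ F] {V : Set E} (hV : IsOpen V)
    {g : E × ℝ → F} (hg : ContinuousOn g (V ×ˢ univ)) (a b : ℝ) :
    ContinuousOn (fun x => ∫ s in a..b, g (x, s)) V := by
  intro x₀ hx₀
  obtain ⟨r, hr, C, hrV, hC⟩ := exists_ball_bound hV hg a b hx₀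
  apply ContinuousAt.continuousWithinAt
  apply intervalIntegral.continuousAt_of_dominated_interval (bound := fun _ => C)
  · filter_upwards [Metric.ball_mem_nhds x₀ hr] with x hx
    exact (continuous_section hg (hrV hx)).aestronglyMeasurable
  · filter_upwards [Metric.ball_mem_nhds x₀ hr] with x hx
    exact .of_forall fun s hs => hC x hx s (uIoc_subset_uIcc hs)
  · exact intervalIntegrable_const
  · refine .of_forall fun s _ => ?_
    have : ContinuousAt g (x₀, s) :=
      hg.continuousAt ((hV.prod isOpen_univ).mem_nhds ⟨hx₀, mem_univ s⟩)
    exact ContinuousAt.comp (f := fun x => (x, s)) this (by fun_prop)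

theorem hasFDerivAt_intervalIntegral_param {E : Type} [NormedAddCommGroup E] [NormedSpace ℝ E] [ProperSpace E]
    {F : Type} [NormedAddCommGroup F] [NormedSpace ℝ F]
    {V : Set E} (hV : IsOpen V)
    {g : E × ℝ → F} (hg : ContDiffOn ℝ 1 g (V ×ˢ univ)) (a b : ℝ) {x₀ : E} (hx₀ : x₀ ∈ V) :
    HasFDerivAt (fun x => ∫ s in a..b, g (x, s))
      (∫ s in a..b, (fderiv ℝ g (x₀, s)).comp (ContinuousLinearMap.inl ℝ E ℝ)) x₀ := by
  have hO : IsOpen (V ×ˢ (univ : Set ℝ)) := hV.prod isOpen_univ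
  have hg' : ContinuousOn (fun y => (fderiv ℝ g y).comp (ContinuousLinearMap.inl ℝ E ℝ))
      (V ×ˢ univ) :=
    (hg.continuousOn_fderiv_of_isOpen hO le_rfl).clm_comp continuousOn_const
  obtain ⟨r, hr, C, hrV, hC⟩ := exists_ball_bound hV hg' a b hx₀
  refine intervalIntegral.hasFDerivAt_integral_of_dominated_of_fderiv_le
    (F := fun x s => g (x, s))
    (F' := fun x s => (fderiv ℝ g (x, s)).comp (ContinuousLinearMap.inl ℝ E ℝ))
    (bound := fun _ => C) (Metric.ball_mem_nhds x₀ hr) ?_ ?_ ?_ ?_ ?_ ?_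
  · filter_upwards [Metric.ball_mem_nhds x₀ hr] with x hx
    exact (continuous_section hg.continuousOn (hrV hx)).aestronglyMeasurable
  · exact (continuous_section hg.continuousOn hx₀).intervalIntegrable _ _
  · exact (continuous_section hg' hx₀).aestronglyMeasurable
  · exact .of_forall fun s hs x hx => hC x hx s (uIoc_subset_uIcc hs)
  · exact intervalIntegrable_const
  · refine .of_forall fun s _ x hx => ?_
    have h1 : HasFDerivAt g (fderiv ℝ g (x, s)) (x, s) :=
      ((hg.contDiffAt (hO.mem_nhds ⟨hrV hx, mem_univ s⟩)).differentiableAt (by simp)).hasFDerivAt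
    exact HasFDerivAt.comp (f := fun x => (x, s)) x h1 (hasFDerivAt_prodMk_left x s)

/-- The derivative is again a parametric integral, with values in `E →L[ℝ] F`. The codomain is
therefore quantified inside the induction. -/
theorem contDiffOn_intervalIntegral_param_nat {E : Type} [NormedAddCommGroup E] [NormedSpace ℝ E] [ProperSpace E]
    (n : ℕ) : ∀ {F : Type} [NormedAddCommGroup F]
    [NormedSpace ℝ F] {V : Set E} (_ : IsOpen V)
    {g : E × ℝ → F} (_ : ContDiffOn ℝ n g (V ×ˢ univ)) (a b : ℝ),
    ContDiffOn ℝ n (fun x => ∫ s in a..b, g (x, s)) V := by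
  induction n with
  | zero =>
    intro F _ _ V hV g hg a b
    rw [Nat.cast_zero, contDiffOn_zero] at hg ⊢
    exact continuousOn_intervalIntegral_param hV hg a b
  | succ n ih =>
    intro F _ _ V hV g hg a b
    have hO : IsOpen (V ×ˢ (univ : Set ℝ)) := hV.prod isOpen_univ
    have hd : ∀ x ∈ V, HasFDerivAt (fun x => ∫ s in a..b, g (x, s))
      (∫ s in a..b, (fderiv ℝ g (x, s)).comp (ContinuousLinearMap.inl ℝ E ℝ)) x :=
      fun x hx => hasFDerivAt_intervalIntegral_param hV
        (hg.of_le (by norm_cast; omega)) a b hx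
    rw [Nat.cast_succ, contDiffOn_succ_iff_fderiv_of_isOpen hV]
    refine ⟨fun x hx => (hd x hx).differentiableAt.differentiableWithinAt, by simp, ?_⟩
    have h1 : ContDiffOn ℝ n (fun y => (fderiv ℝ g y).comp (ContinuousLinearMap.inl ℝ E ℝ))
        (V ×ˢ univ) := (hg.fderiv_of_isOpen hO (by simp)).clm_comp contDiffOn_const
    exact (ih hV h1 a b).congr fun x hx => (hd x hx).fderiv

theorem contDiffOn_intervalIntegral_param {E : Type} [NormedAddCommGroup E] [NormedSpace ℝ E] [ProperSpace E]
    {F : Type} [NormedAddCommGroup F]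
    [NormedSpace ℝ F] {V : Set E} (hV : IsOpen V)
    {g : E × ℝ → F} (hg : ContDiffOn ℝ ∞ g (V ×ˢ univ)) (a b : ℝ) :
    ContDiffOn ℝ ∞ (fun x => ∫ s in a..b, g (x, s)) V :=
  contDiffOn_infty.2 fun n =>
    contDiffOn_intervalIntegral_param_nat n hV (hg.of_le (by exact_mod_cast le_top)) a b

end Parametric

/-! ### Taylor coefficients in one variable. -/

section IteratedDeriv

/-- Each derivative in the first variable is the full derivative applied to `(1, 0)`, so joint
smoothness persists. -/
theorem contDiffOn_iteratedDeriv_param {E : Type} [NormedAddCommGroup E] [NormedSpace ℝ E]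
    {O : Set (ℝ × E)} (hO : IsOpen O) {f : ℝ × E → ℝ} (hf : ContDiffOn ℝ ∞ f O) (n : ℕ) :
    ContDiffOn ℝ ∞ (fun x : ℝ × E => iteratedDeriv n (fun e => f (e, x.2)) x.1) O := by
  induction n with
  | zero => simpa using hf
  | succ n ih =>
    have h1 : ContDiffOn ℝ ∞ (fun x => fderiv ℝ
        (fun x : ℝ × E => iteratedDeriv n (fun e => f (e, x.2)) x.1) x ((1 : ℝ), (0 : E))) O :=
      (ih.fderiv_of_isOpen hO (by simp)).clm_apply contDiffOn_const
    refine h1.congr fun x hx => ?_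
    have h2 := ((ih.contDiffAt (hO.mem_nhds hx)).differentiableAt (by simp)).hasFDerivAt
    have h3 : HasDerivAt (fun e => (e, x.2)) ((1 : ℝ), (0 : E)) x.1 :=
      (hasDerivAt_id x.1).prodMk (hasDerivAt_const _ _)
    rw [iteratedDeriv_succ]
    exact (HasFDerivAt.comp_hasDerivAt (f := fun e => (e, x.2)) x.1 h2 h3).deriv

theorem coeff_eq_zero_of_isLittleO {n : ℕ} {a : ℕ → ℝ}
    (h : (fun x : ℝ => ∑ j ∈ Finset.range (n + 1), x ^ j * a j) =o[𝓝 0] fun x => x ^ n) :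
    ∀ m ≤ n, a m = 0 := by
  intro m
  induction m using Nat.strong_induction_on with
  | _ m ih =>
    intro hm
    have hsum : ∀ x : ℝ, x ^ m * a m =
        (∑ j ∈ Finset.range (n + 1), x ^ j * a j)
          - ∑ j ∈ Finset.Ico (m + 1) (n + 1), x ^ j * a j := by
      intro x
      rw [← Finset.sum_range_add_sum_Ico _ (show m + 1 ≤ n + 1 by omega), Finset.sum_range_succ,
        Finset.sum_eq_zero]
      · ring
      · intro j hj
        rw [ih j (Finset.mem_range.1 hj) (by have := Finset.mem_range.1 hj; omega), mul_zero]
    have h1 : (fun x : ℝ => ∑ j ∈ Finset.range (n + 1), x ^ j * a j) =o[𝓝 0] fun x => x ^ m := by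
      rcases hm.eq_or_lt with rfl | hlt
      · exact h
      · exact h.trans (isLittleO_pow_pow hlt)
    have h2 : (fun x : ℝ => ∑ j ∈ Finset.Ico (m + 1) (n + 1), x ^ j * a j)
        =o[𝓝 0] fun x => x ^ m := by
      refine IsLittleO.fun_sum (s := Finset.Ico (m + 1) (n + 1)) (A := fun j (x : ℝ) => x ^ j * a j)
        fun j hj => ?_
      have := (isLittleO_pow_pow (𝕜 := ℝ) (show m < j by have := Finset.mem_Ico.1 hj; omega))
      simpa [mul_comm] using this.const_mul_left (a j)
    have h3 := (h1.sub h2).congr_left fun x => (hsum x).symm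
    by_contra ha
    have h4 : (fun x : ℝ => x ^ m) =o[𝓝 0] fun x : ℝ => x ^ m := by
      have := h3.const_mul_left (a m)⁻¹
      refine this.congr_left fun x => ?_
      field_simp
    refine isLittleO_irrefl (Eventually.frequently ?_)
      (h4.mono (nhdsWithin_le_nhds (s := {(0 : ℝ)}ᶜ)))
    filter_upwards [self_mem_nhdsWithin] with x hx
    exact pow_ne_zero _ hx

/-- Uniqueness of the Taylor polynomial: it differs from `c x ^ n` by `o(x ^ n)`, so the two have
equal coefficients. -/
theorem iteratedDeriv_of_isLittleO {n : ℕ} {f : ℝ → ℝ} (hf : ContDiffAt ℝ n f 0) {c : ℝ}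
    (h : (fun x => f x - c * x ^ n) =o[𝓝 0] fun x => x ^ n) :
    iteratedDeriv n f 0 = n.factorial * c := by
  obtain ⟨u, hu, hfu⟩ := hf.contDiffOn (m := n) le_rfl (by simp)
  obtain ⟨r, hr, hru⟩ := Metric.mem_nhds_iff.1 hu
  have h0 : (0 : ℝ) ∈ Metric.ball (0 : ℝ) r := Metric.mem_ball_self hr
  have hT := taylor_isLittleO (convex_ball (0 : ℝ) r) h0 (hfu.mono hru)
  rw [Metric.isOpen_ball.nhdsWithin_eq h0] at hT
  simp only [sub_zero] at hT
  have h1 := h.sub hT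
  set a : ℕ → ℝ := fun j => (j.factorial : ℝ)⁻¹ * iteratedDerivWithin j f (Metric.ball 0 r) 0
    - if j = n then c else 0 with ha
  have h2 : (fun x : ℝ => ∑ j ∈ Finset.range (n + 1), x ^ j * a j) =o[𝓝 0] fun x => x ^ n := by
    refine h1.congr_left fun x => ?_
    rw [taylor_within_apply]
    simp only [ha, mul_sub, Finset.sum_sub_distrib, mul_ite, mul_zero, sub_zero, smul_eq_mul]
    rw [Finset.sum_ite_eq' (Finset.range (n + 1)) n, if_pos (by simp)]
    have : ∀ j, x ^ j * ((j.factorial : ℝ)⁻¹ * iteratedDerivWithin j f (Metric.ball 0 r) 0)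
      = (j.factorial : ℝ)⁻¹ * x ^ j * iteratedDerivWithin j f (Metric.ball 0 r) 0 :=
      fun j => by ring
    simp only [this]
    ring
  have h3 := coeff_eq_zero_of_isLittleO h2 n le_rfl
  simp only [ha, if_true] at h3
  rw [iteratedDerivWithin_eq_iteratedDeriv Metric.isOpen_ball.uniqueDiffOn hf h0] at h3
  have : (n.factorial : ℝ) ≠ 0 := by positivity
  field_simp at h3
  linarith

end IteratedDeriv

/-! ### Coefficients of `εⁿ` in a composed formal series. -/

section OrderCoeff

theorem orderCoeff_zero (g : ℝ → ℝ → ℝ) (φ I : ℕ → ℝ) : orderCoeff 0 g φ I = g (φ 0) (I 0) := by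
  simp [orderCoeff]

theorem orderCoeff_congr {n : ℕ} (g : ℝ → ℝ → ℝ) {φ I φ' I' : ℕ → ℝ}
    (h : ∀ j ≤ n, φ j = φ' j) (h' : ∀ j ≤ n, I j = I' j) :
    orderCoeff n g φ I = orderCoeff n g φ' I' := by
  unfold orderCoeff
  have e1 : ∀ ε : ℝ, ∑ j ∈ Finset.range (n + 1), ε ^ j * φ j
      = ∑ j ∈ Finset.range (n + 1), ε ^ j * φ' j := fun ε =>
    Finset.sum_congr rfl fun j hj => by rw [h j (by have := Finset.mem_range.1 hj; omega)]
  have e2 : ∀ ε : ℝ, ∑ j ∈ Finset.range (n + 1), ε ^ j * I j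
      = ∑ j ∈ Finset.range (n + 1), ε ^ j * I' j := fun ε =>
    Finset.sum_congr rfl fun j hj => by rw [h' j (by have := Finset.mem_range.1 hj; omega)]
  simp only [e1, e2]

/-- A translation of the zeroth coefficient by a period of `g` has no effect. -/
theorem orderCoeff_shift {n : ℕ} {g : ℝ → ℝ → ℝ} {c : ℝ} {φ I φ' I' : ℕ → ℝ}
    (hg : ∀ᶠ y in 𝓝 (I 0), ∀ x, g (x + c) y = g x y)
    (h0 : φ' 0 = φ 0 + c) (h : ∀ j, 1 ≤ j → j ≤ n → φ' j = φ j)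
    (h' : ∀ j ≤ n, I' j = I j) :
    orderCoeff n g φ' I' = orderCoeff n g φ I := by
  unfold orderCoeff
  have e1 : ∀ ε : ℝ, ∑ j ∈ Finset.range (n + 1), ε ^ j * φ' j
      = ∑ j ∈ Finset.range (n + 1), ε ^ j * φ j + c := fun ε => by
    rw [Finset.sum_range_succ', Finset.sum_range_succ', h0, pow_zero, one_mul, one_mul, ← add_assoc]
    congr 2
    exact Finset.sum_congr rfl fun j hj => by
      rw [h (j + 1) (by omega) (by have := Finset.mem_range.1 hj; omega)]
  have e2 : ∀ ε : ℝ, ∑ j ∈ Finset.range (n + 1), ε ^ j * I' j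
      = ∑ j ∈ Finset.range (n + 1), ε ^ j * I j := fun ε =>
    Finset.sum_congr rfl fun j hj => by rw [h' j (by have := Finset.mem_range.1 hj; omega)]
  have hlim : Tendsto (fun ε : ℝ => ∑ j ∈ Finset.range (n + 1), ε ^ j * I j) (𝓝 0) (𝓝 (I 0)) := by
    have hc : Continuous fun ε : ℝ => ∑ j ∈ Finset.range (n + 1), ε ^ j * I j := by fun_prop
    have h0 := hc.tendsto 0
    rw [Finset.sum_range_succ'] at h0
    simpa using h0
  congr 1
  -- Periodicity is known only for actions near `I 0`, so the two functions of `ε` are compared only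
  -- near `0`.
  apply Filter.EventuallyEq.iteratedDeriv_eq
  filter_upwards [hlim.eventually hg] with ε hε
  rw [e1, e2, hε]

/-- Time and the finitely many coefficients are treated as independent parameters. The
`ε`-derivative is smooth in all of them, and is then restricted to a continuous curve at `ε = 0`. -/
theorem continuous_orderCoeff (n : ℕ) {g : ℝ → ℝ → ℝ → ℝ} {W : Set ℝ} (hW : IsOpen W)
    (hg : ContDiffOn ℝ ∞ (fun x : ℝ × ℝ × ℝ => g x.1 x.2.1 x.2.2) {x | x.2.2 ∈ W})
    {φ I : ℕ → ℝ → ℝ} (hφ : ∀ j ≤ n, Continuous (φ j)) (hI : ∀ j ≤ n, Continuous (I j))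
    (h0 : ∀ τ, I 0 τ ∈ W) :
    Continuous fun τ => orderCoeff n (g τ) (fun j => φ j τ) (fun j => I j τ) := by
  let P : ℝ × (ℝ × (Fin (n + 1) → ℝ) × (Fin (n + 1) → ℝ)) → ℝ × ℝ × ℝ := fun x =>
    (x.2.1, ∑ j : Fin (n + 1), x.1 ^ (j : ℕ) * x.2.2.1 j,
      ∑ j : Fin (n + 1), x.1 ^ (j : ℕ) * x.2.2.2 j)
  have hP : ContDiff ℝ ∞ P := by fun_prop
  have hO : IsOpen (P ⁻¹' {x | x.2.2 ∈ W}) :=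
    (hW.preimage (by fun_prop : Continuous fun x : ℝ × ℝ × ℝ => x.2.2)).preimage hP.continuous
  have h1 := contDiffOn_iteratedDeriv_param hO
    (hg.comp hP.contDiffOn (fun x hx => hx)) n
  let Q : ℝ → ℝ × (ℝ × (Fin (n + 1) → ℝ) × (Fin (n + 1) → ℝ)) := fun τ =>
    (0, τ, fun j => φ j τ, fun j => I j τ)
  have hQ : Continuous Q := by
    refine continuous_const.prodMk (continuous_id.prodMk (.prodMk ?_ ?_))
    · exact continuous_pi fun j => hφ j (by omega)
    · exact continuous_pi fun j => hI j (by omega)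
  have hmem : ∀ τ, Q τ ∈ P ⁻¹' {x | x.2.2 ∈ W} := fun τ => by
    simp only [mem_preimage, mem_ofPred_eq, P, Q]
    rw [Fin.sum_univ_succ]
    simpa using h0 τ
  have h2 := (h1.continuousOn.comp_continuous hQ hmem).div_const (n.factorial : ℝ)
  refine h2.congr fun τ => ?_
  simp only [orderCoeff, P, Q, Function.comp_def, Finset.sum_range]

/-- Dependence of `orderCoeff n` on the coefficients of order `n`. -/
theorem orderCoeff_top {n : ℕ} (hn : 1 ≤ n) {g : ℝ → ℝ → ℝ} {φ I φ' I' : ℕ → ℝ}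
    (hg : ContDiffAt ℝ ∞ (fun x : ℝ × ℝ => g x.1 x.2) (φ 0, I 0))
    (h : ∀ j < n, φ' j = φ j) (h' : ∀ j < n, I' j = I j) :
    orderCoeff n g φ' I' = orderCoeff n g φ I +
      fderiv ℝ (fun x : ℝ × ℝ => g x.1 x.2) (φ 0, I 0) (φ' n - φ n, I' n - I n) := by
  set G : ℝ × ℝ → ℝ := fun x => g x.1 x.2 with hG
  set L := fderiv ℝ G (φ 0, I 0)
  set v : ℝ × ℝ := (φ' n - φ n, I' n - I n)
  let P : ℝ → ℝ × ℝ := fun ε => (∑ j ∈ Finset.range (n + 1), ε ^ j * φ j,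
    ∑ j ∈ Finset.range (n + 1), ε ^ j * I j)
  let P' : ℝ → ℝ × ℝ := fun ε => (∑ j ∈ Finset.range (n + 1), ε ^ j * φ' j,
    ∑ j ∈ Finset.range (n + 1), ε ^ j * I' j)
  -- The truncated series differ only in their last term.
  have hPP : ∀ ε, P' ε - P ε = ε ^ n • v := fun ε => by
    have e : ∀ a a' : ℕ → ℝ, (∀ j < n, a' j = a j) → ∑ j ∈ Finset.range (n + 1), ε ^ j * a' j
      - ∑ j ∈ Finset.range (n + 1), ε ^ j * a j = ε ^ n * (a' n - a n) := fun a a' haa => by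
      rw [Finset.sum_range_succ, Finset.sum_range_succ,
        Finset.sum_congr rfl fun j hj => by rw [haa j (Finset.mem_range.1 hj)]]
      ring
    ext
    · simpa [P, P', v] using e φ φ' h
    · simpa [P, P', v] using e I I' h'
  have hz : ∀ a : ℕ → ℝ, ∑ j ∈ Finset.range (n + 1), (0 : ℝ) ^ j * a j = a 0 := fun a => by
    rw [Finset.sum_range_succ']
    simp
  have hP0 : P 0 = (φ 0, I 0) := by simp only [P, hz]
  have hP'0 : P' 0 = (φ 0, I 0) := by simp only [P', hz, h 0 hn, h' 0 hn]
  have hPc : ContDiff ℝ ∞ P := by fun_prop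
  have hP'c : ContDiff ℝ ∞ P' := by fun_prop
  have hc : ContDiffAt ℝ ∞ (fun ε => G (P ε)) 0 :=
    ContDiffAt.comp (g := G) (f := P) 0 (by rw [hP0]; exact hg) hPc.contDiffAt
  have hc' : ContDiffAt ℝ ∞ (fun ε => G (P' ε)) 0 :=
    ContDiffAt.comp (g := G) (f := P') 0 (by rw [hP'0]; exact hg) hP'c.contDiffAt
  -- Both `P ε` and `P' ε` move with `ε`, so strict differentiability is what gives `G (P' ε) - G (P
  -- ε) = ε ^ n L v + o(ε ^ n)`.
  have hs : HasStrictFDerivAt G L (φ 0, I 0) := hg.hasStrictFDerivAt (by simp)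
  have hlim : Tendsto (fun ε => (P' ε, P ε)) (𝓝 0) (𝓝 ((φ 0, I 0), (φ 0, I 0))) := by
    have := (hP'c.continuous.prodMk hPc.continuous).tendsto 0
    rwa [hP0, hP'0] at this
  have ho := hs.isLittleO.comp_tendsto hlim
  have ho' : (fun ε => (G (P' ε) - G (P ε)) - L v * ε ^ n) =o[𝓝 0] fun ε : ℝ => ε ^ n := by
    have e1 : (fun ε : ℝ => ε ^ n • v) =O[𝓝 0] fun ε : ℝ => ε ^ n := by
      refine IsBigO.of_bound ‖v‖ (.of_forall fun ε => ?_)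
      rw [norm_smul, mul_comm]
    refine (IsLittleO.trans_isBigO (ho.congr (fun ε => ?_) (fun ε => ?_)) e1)
    · simp only [Function.comp, hPP, map_smul, smul_eq_mul]
      ring
    · simp only [Function.comp, hPP]
  have hd := iteratedDeriv_of_isLittleO (n := n)
    ((hc'.sub hc).of_le (by exact_mod_cast le_top)) ho'
  have hsub : iteratedDeriv n (fun ε => G (P' ε) - G (P ε)) 0
      = iteratedDeriv n (fun ε => G (P' ε)) 0 - iteratedDeriv n (fun ε => G (P ε)) 0 :=
    iteratedDeriv_sub (hc'.of_le (by exact_mod_cast le_top)) (hc.of_le (by exact_mod_cast le_top))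
  have hfac : (n.factorial : ℝ) ≠ 0 := by positivity
  have h1 : orderCoeff n g φ' I' = iteratedDeriv n (fun ε => G (P' ε)) 0 / n.factorial := rfl
  have h2 : orderCoeff n g φ I = iteratedDeriv n (fun ε => G (P ε)) 0 / n.factorial := rfl
  have h3 : iteratedDeriv n (fun ε => G (P' ε)) 0 - iteratedDeriv n (fun ε => G (P ε)) 0
    = n.factorial * L v := hsub.symm.trans hd
  rw [h1, h2]
  field_simp
  linarith

end OrderCoeff

/-! ### Primitives with parameters and integrals of even periodic functions. -/

section Primitive

/-- The rescaling `ψ = s x₂` turns the variable endpoint into a parameter of an integral over `[0,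
1]`. -/
theorem contDiffOn_primitive_param {V : Set ℝ} (hV : IsOpen V) {h : ℝ × ℝ → ℝ}
    (hh : ContDiffOn ℝ ∞ h (V ×ˢ univ)) :
    ContDiffOn ℝ ∞ (fun x : ℝ × ℝ => ∫ ψ in (0 : ℝ)..x.2, h (x.1, ψ)) (V ×ˢ univ) := by
  have hO : IsOpen (V ×ˢ (univ : Set ℝ)) := hV.prod isOpen_univ
  have h1 : ContDiffOn ℝ ∞ (fun y : (ℝ × ℝ) × ℝ => h (y.1.1, y.2 * y.1.2))
      ((V ×ˢ (univ : Set ℝ)) ×ˢ univ) :=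
    hh.comp (by fun_prop) fun y hy => ⟨hy.1.1, mem_univ _⟩
  have h2 := (contDiffOn_snd (s := V ×ˢ (univ : Set ℝ)) (𝕜 := ℝ) (n := ∞)).mul
    (contDiffOn_intervalIntegral_param hO h1 0 1)
  refine h2.congr fun x _ => ?_
  simpa using (intervalIntegral.mul_integral_comp_mul_right
    (f := fun ψ => h (x.1, ψ)) (a := 0) (b := 1) x.2).symm

/-- A full period may be centred at `0`, where evenness folds it onto `[0, π/2]`. This yields the
quasi-periods `2K` and `2E`. -/
theorem integral_add_pi_of_even {f : ℝ → ℝ} (hf : Continuous f) (hper : Function.Periodic f Real.pi)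
    (heven : ∀ x, f (-x) = f x) (θ : ℝ) :
    ∫ ψ in (0 : ℝ)..(θ + Real.pi), f ψ
      = (∫ ψ in (0 : ℝ)..θ, f ψ) + 2 * ∫ ψ in (0 : ℝ)..(Real.pi / 2), f ψ := by
  have hi : ∀ a b, IntervalIntegrable f volume a b := fun a b => hf.intervalIntegrable a b
  rw [← intervalIntegral.integral_add_adjacent_intervals (hi 0 θ) (hi θ (θ + Real.pi)),
    hper.intervalIntegral_add_eq θ (-(Real.pi / 2)),
    ← intervalIntegral.integral_add_adjacent_intervals (hi (-(Real.pi / 2)) 0) (hi 0 _)]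
  have h1 : ∫ ψ in (-(Real.pi / 2))..0, f ψ = ∫ ψ in (0 : ℝ)..(Real.pi / 2), f ψ := by
    have := intervalIntegral.integral_comp_neg (a := 0) (b := Real.pi / 2) f
    simp only [heven, neg_zero] at this
    exact this.symm
  rw [h1, show -(Real.pi / 2) + Real.pi = Real.pi / 2 by ring]
  ring

theorem integral_neg_of_even {f : ℝ → ℝ} (heven : ∀ x, f (-x) = f x) (θ : ℝ) :
    ∫ ψ in (0 : ℝ)..(-θ), f ψ = -∫ ψ in (0 : ℝ)..θ, f ψ := by
  have := intervalIntegral.integral_comp_neg (a := 0) (b := θ) f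
  simp only [heven, neg_zero] at this
  rw [this, intervalIntegral.integral_symm]

end Primitive

/-! ### Elliptic integrals and Jacobi functions on the open set `k² < 1`. -/

section Modulus

theorem one_sub_sq_sin_pos {k : ℝ} (hk : k ^ 2 < 1) (θ : ℝ) :
    0 < 1 - k ^ 2 * Real.sin θ ^ 2 := by
  nlinarith [Real.sin_sq_le_one θ, sq_nonneg k, sq_nonneg (Real.sin θ)]

theorem sqrt_one_sub_sq_sin_pos {k : ℝ} (hk : k ^ 2 < 1) (θ : ℝ) :
    0 < Real.sqrt (1 - k ^ 2 * Real.sin θ ^ 2) := Real.sqrt_pos.2 (one_sub_sq_sin_pos hk θ)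

theorem isOpen_sq_lt_one : IsOpen {k : ℝ | k ^ 2 < 1} :=
  isOpen_lt (by fun_prop) (by fun_prop)

theorem contDiffOn_sqrt_one_sub :
    ContDiffOn ℝ ∞ (fun x : ℝ × ℝ => Real.sqrt (1 - x.1 ^ 2 * Real.sin x.2 ^ 2))
      ({k : ℝ | k ^ 2 < 1} ×ˢ univ) :=
  ContDiffOn.sqrt (by fun_prop) fun x hx => (one_sub_sq_sin_pos hx.1 x.2).ne'

theorem contDiffOn_one_div_sqrt_one_sub :
    ContDiffOn ℝ ∞ (fun x : ℝ × ℝ => 1 / Real.sqrt (1 - x.1 ^ 2 * Real.sin x.2 ^ 2))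
      ({k : ℝ | k ^ 2 < 1} ×ˢ univ) :=
  contDiffOn_const.div contDiffOn_sqrt_one_sub fun x hx => (sqrt_one_sub_sq_sin_pos hx.1 x.2).ne'

theorem continuous_sqrt_one_sub (k : ℝ) :
    Continuous fun ψ => Real.sqrt (1 - k ^ 2 * Real.sin ψ ^ 2) := by fun_prop

theorem continuous_one_div_sqrt_one_sub {k : ℝ} (hk : k ^ 2 < 1) :
    Continuous fun ψ => 1 / Real.sqrt (1 - k ^ 2 * Real.sin ψ ^ 2) :=
  continuous_const.div (continuous_sqrt_one_sub k) fun ψ => (sqrt_one_sub_sq_sin_pos hk ψ).ne'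

/-- The incomplete Legendre integral of the second kind, as a function of the amplitude. -/
def legendreE (k θ : ℝ) : ℝ := ∫ ψ in (0 : ℝ)..θ, Real.sqrt (1 - k ^ 2 * Real.sin ψ ^ 2)

theorem contDiffOn_incompleteF : ContDiffOn ℝ ∞ (fun x : ℝ × ℝ => incompleteF x.1 x.2)
    ({k : ℝ | k ^ 2 < 1} ×ˢ univ) :=
  contDiffOn_primitive_param isOpen_sq_lt_one contDiffOn_one_div_sqrt_one_sub

theorem contDiffOn_legendreE : ContDiffOn ℝ ∞ (fun x : ℝ × ℝ => legendreE x.1 x.2)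
    ({k : ℝ | k ^ 2 < 1} ×ˢ univ) :=
  contDiffOn_primitive_param isOpen_sq_lt_one contDiffOn_sqrt_one_sub

theorem contDiffOn_ellipticK : ContDiffOn ℝ ∞ ellipticK {k : ℝ | k ^ 2 < 1} :=
  contDiffOn_incompleteF.comp (f := fun k => (k, Real.pi / 2)) (by fun_prop)
    fun _ hk => ⟨hk, mem_univ _⟩

theorem contDiffOn_ellipticE : ContDiffOn ℝ ∞ ellipticE {k : ℝ | k ^ 2 < 1} :=
  contDiffOn_legendreE.comp (f := fun k => (k, Real.pi / 2)) (by fun_prop)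
    fun _ hk => ⟨hk, mem_univ _⟩

theorem hasDerivAt_incompleteF {k : ℝ} (hk : k ^ 2 < 1) (θ : ℝ) :
    HasDerivAt (incompleteF k) (1 / Real.sqrt (1 - k ^ 2 * Real.sin θ ^ 2)) θ :=
  intervalIntegral.integral_hasDerivAt_right
    ((continuous_one_div_sqrt_one_sub hk).intervalIntegrable _ _)
    ((continuous_one_div_sqrt_one_sub hk).stronglyMeasurableAtFilter _ _)
    (continuous_one_div_sqrt_one_sub hk).continuousAt

theorem hasDerivAt_legendreE (k θ : ℝ) :
    HasDerivAt (legendreE k) (Real.sqrt (1 - k ^ 2 * Real.sin θ ^ 2)) θ :=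
  intervalIntegral.integral_hasDerivAt_right
    ((continuous_sqrt_one_sub k).intervalIntegrable _ _)
    ((continuous_sqrt_one_sub k).stronglyMeasurableAtFilter _ _)
    (continuous_sqrt_one_sub k).continuousAt

theorem continuous_incompleteF {k : ℝ} (hk : k ^ 2 < 1) : Continuous (incompleteF k) :=
  continuous_iff_continuousAt.2 fun θ => (hasDerivAt_incompleteF hk θ).continuousAt

theorem strictMono_incompleteF {k : ℝ} (hk : k ^ 2 < 1) : StrictMono (incompleteF k) :=
  strictMono_of_deriv_pos fun θ => by
    rw [(hasDerivAt_incompleteF hk θ).deriv]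
    exact one_div_pos.2 (sqrt_one_sub_sq_sin_pos hk θ)

@[simp] theorem incompleteF_zero (k : ℝ) : incompleteF k 0 = 0 := by simp [incompleteF]

theorem incompleteF_pi_div_two (k : ℝ) : incompleteF k (Real.pi / 2) = ellipticK k := rfl

theorem incompleteF_neg (k θ : ℝ) : incompleteF k (-θ) = -incompleteF k θ :=
  integral_neg_of_even (fun x => by simp) θ

theorem incompleteF_add_pi {k : ℝ} (hk : k ^ 2 < 1) (θ : ℝ) :
    incompleteF k (θ + Real.pi) = incompleteF k θ + 2 * ellipticK k :=
  integral_add_pi_of_even (continuous_one_div_sqrt_one_sub hk) (fun x => by simp)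
    (fun x => by simp) θ

theorem legendreE_add_pi (k θ : ℝ) :
    legendreE k (θ + Real.pi) = legendreE k θ + 2 * ellipticE k :=
  integral_add_pi_of_even (continuous_sqrt_one_sub k) (fun x => by simp)
    (fun x => by simp) θ

theorem le_incompleteF {k : ℝ} (hk : k ^ 2 < 1) {θ : ℝ} (hθ : 0 ≤ θ) : θ ≤ incompleteF k θ := by
  have h := intervalIntegral.integral_mono_on (μ := volume) (f := fun _ => (1 : ℝ)) hθ
    intervalIntegrable_const ((continuous_one_div_sqrt_one_sub hk).intervalIntegrable 0 θ)
    fun ψ _ => by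
      rw [le_div_iff₀ (sqrt_one_sub_sq_sin_pos hk ψ), one_mul, Real.sqrt_le_one]
      nlinarith [mul_nonneg (sq_nonneg k) (sq_nonneg (Real.sin ψ))]
  simpa [incompleteF] using h

theorem surjective_incompleteF {k : ℝ} (hk : k ^ 2 < 1) : Function.Surjective (incompleteF k) := by
  refine (continuous_incompleteF hk).surjective ?_ ?_
  · exact tendsto_atTop_mono' _ ((eventually_ge_atTop 0).mono fun θ hθ => le_incompleteF hk hθ)
      tendsto_id
  · refine tendsto_atBot_mono' _ ((eventually_le_atBot 0).mono fun θ hθ => ?_) tendsto_id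
    have := le_incompleteF hk (neg_nonneg.2 hθ)
    rw [incompleteF_neg] at this
    simp only [id]
    linarith

theorem ellipticK_pos {k : ℝ} (hk : k ^ 2 < 1) : 0 < ellipticK k := by
  have := le_incompleteF hk (θ := Real.pi / 2) (by positivity)
  rw [incompleteF_pi_div_two] at this
  have := Real.pi_pos
  linarith

theorem incompleteF_am {k : ℝ} (hk : k ^ 2 < 1) (u : ℝ) : incompleteF k (am u k) = u :=
  Function.invFun_eq (surjective_incompleteF hk u)

theorem am_incompleteF {k : ℝ} (hk : k ^ 2 < 1) (θ : ℝ) : am (incompleteF k θ) k = θ :=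
  Function.leftInverse_invFun (strictMono_incompleteF hk).injective θ

theorem am_eq {k : ℝ} (hk : k ^ 2 < 1) {θ u : ℝ} (h : incompleteF k θ = u) : am u k = θ := by
  rw [← h, am_incompleteF hk]

theorem am_zero {k : ℝ} (hk : k ^ 2 < 1) : am 0 k = 0 := am_eq hk (by simp)

theorem am_ellipticK {k : ℝ} (hk : k ^ 2 < 1) : am (ellipticK k) k = Real.pi / 2 := am_eq hk rfl

theorem am_neg {k : ℝ} (hk : k ^ 2 < 1) (u : ℝ) : am (-u) k = -am u k :=
  am_eq hk (by rw [incompleteF_neg, incompleteF_am hk])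

theorem am_add_two_mul {k : ℝ} (hk : k ^ 2 < 1) (u : ℝ) :
    am (u + 2 * ellipticK k) k = am u k + Real.pi :=
  am_eq hk (by rw [incompleteF_add_pi hk, incompleteF_am hk])

/-- Inverse function theorem for `(k, θ) ↦ (incompleteF k θ, k)`. Its derivative is invertible
because `∂F/∂θ ≠ 0`, and the amplitude is the second component of the local inverse. -/
theorem contDiffAt_am {k : ℝ} (hk : k ^ 2 < 1) (u : ℝ) :
    ContDiffAt ℝ ∞ (fun x : ℝ × ℝ => am x.1 x.2) (u, k) := by
  set θ := am u k with hθ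
  have hO : IsOpen ({k : ℝ | k ^ 2 < 1} ×ˢ (univ : Set ℝ)) := isOpen_sq_lt_one.prod isOpen_univ
  let Φ : ℝ × ℝ → ℝ × ℝ := fun x => (incompleteF x.1 x.2, x.1)
  have hF : ContDiffAt ℝ ∞ (fun x : ℝ × ℝ => incompleteF x.1 x.2) (k, θ) :=
    contDiffOn_incompleteF.contDiffAt (hO.mem_nhds (mk_mem_prod hk (mem_univ θ)))
  have hΦ : ContDiffAt ℝ ∞ Φ (k, θ) :=
    hF.prodMk contDiffAt_fst
  have hΦ0 : Φ (k, θ) = (u, k) := by simp [Φ, hθ, incompleteF_am hk]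
  set D := fderiv ℝ (fun x : ℝ × ℝ => incompleteF x.1 x.2) (k, θ)
  have hD : HasFDerivAt (fun x : ℝ × ℝ => incompleteF x.1 x.2) D (k, θ) :=
    (hF.differentiableAt (by simp)).hasFDerivAt
  set d := 1 / Real.sqrt (1 - k ^ 2 * Real.sin θ ^ 2)
  have hd : d ≠ 0 := (one_div_pos.2 (sqrt_one_sub_sq_sin_pos hk θ)).ne'
  have hD2 : D (0, 1) = d := by
    have h3 : HasDerivAt (fun e => (k, e)) ((0 : ℝ), (1 : ℝ)) θ :=
      (hasDerivAt_const _ _).prodMk (hasDerivAt_id _)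
    exact (HasFDerivAt.comp_hasDerivAt (f := fun e => (k, e)) θ hD h3).unique
      (hasDerivAt_incompleteF hk θ)
  have hDx : ∀ x : ℝ × ℝ, D x = x.1 * D (1, 0) + x.2 * d := fun x => by
    have : x = x.1 • ((1 : ℝ), (0 : ℝ)) + x.2 • ((0 : ℝ), (1 : ℝ)) := by ext <;> simp
    rw [this, map_add, map_smul, map_smul, hD2]
    simp
  have hΦ' : HasFDerivAt Φ (D.prod (ContinuousLinearMap.fst ℝ ℝ ℝ)) (k, θ) :=
    hD.prodMk hasFDerivAt_fst
  -- The system `x₁ D(1,0) + x₂ d = a`, `x₁ = b` is solved by `x₁ = b`, `x₂ = d⁻¹ (a - D(1,0) b)`.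
  let L : (ℝ × ℝ) ≃L[ℝ] (ℝ × ℝ) := ContinuousLinearEquiv.equivOfInverse
    (D.prod (ContinuousLinearMap.fst ℝ ℝ ℝ))
    ((ContinuousLinearMap.snd ℝ ℝ ℝ).prod
      (d⁻¹ • (ContinuousLinearMap.fst ℝ ℝ ℝ - D (1, 0) • ContinuousLinearMap.snd ℝ ℝ ℝ)))
    (fun x => by
      ext
      · simp
      · simp
        rw [hDx x]
        field_simp
        ring)
    (fun x => by
      ext
      · simp
        rw [hDx]
        field_simp
        ring
      · simp)
  have hΦL : HasFDerivAt Φ (L : ℝ × ℝ →L[ℝ] ℝ × ℝ) (k, θ) := hΦ'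
  have hinv := hΦ.to_localInverse hΦL (by simp)
  rw [hΦ0] at hinv
  set ψ := hΦ.localInverse hΦL (by simp) with hψ
  have hright : ∀ᶠ y in 𝓝 (u, k), Φ (ψ y) = y := by
    have := (hΦ.hasStrictFDerivAt' hΦL (by simp)).eventually_right_inverse
    rwa [hΦ0] at this
  refine (contDiffAt_snd.comp (u, k) hinv).congr_of_eventuallyEq ?_
  have hkn : ∀ᶠ y : ℝ × ℝ in 𝓝 (u, k), y.2 ^ 2 < 1 :=
    (isOpen_sq_lt_one.preimage continuous_snd).mem_nhds hk
  filter_upwards [hright, hkn] with y hy hyk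
  have h1 : (ψ y).1 = y.2 := congrArg Prod.snd hy
  have h2 : incompleteF (ψ y).1 (ψ y).2 = y.1 := congrArg Prod.fst hy
  rw [h1] at h2
  exact am_eq hyk h2

theorem continuous_am {k : ℝ} (hk : k ^ 2 < 1) : Continuous fun u => am u k :=
  continuous_iff_continuousAt.2 fun u =>
    ContinuousAt.comp (f := fun u => (u, k)) (contDiffAt_am hk u).continuousAt (by fun_prop)

theorem dn_pos {k : ℝ} (hk : k ^ 2 < 1) (u : ℝ) : 0 < dn u k := sqrt_one_sub_sq_sin_pos hk _

theorem dn_sq {k : ℝ} (hk : k ^ 2 < 1) (u : ℝ) : dn u k ^ 2 = 1 - k ^ 2 * sn u k ^ 2 :=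
  Real.sq_sqrt (one_sub_sq_sin_pos hk _).le

theorem sn_sq_add_cn_sq (u k : ℝ) : sn u k ^ 2 + cn u k ^ 2 = 1 := Real.sin_sq_add_cos_sq _

theorem hasDerivAt_am {k : ℝ} (hk : k ^ 2 < 1) (u : ℝ) :
    HasDerivAt (fun u => am u k) (dn u k) u := by
  have h := HasDerivAt.of_local_left_inverse (continuous_am hk).continuousAt
    (hasDerivAt_incompleteF hk (am u k)) (one_div_pos.2 (sqrt_one_sub_sq_sin_pos hk _)).ne'
    (.of_forall (incompleteF_am hk))
  simpa [dn, sn] using h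

theorem hasDerivAt_sn {k : ℝ} (hk : k ^ 2 < 1) (u : ℝ) :
    HasDerivAt (fun u => sn u k) (cn u k * dn u k) u :=
  (hasDerivAt_am hk u).sin

theorem hasDerivAt_cn {k : ℝ} (hk : k ^ 2 < 1) (u : ℝ) :
    HasDerivAt (fun u => cn u k) (-(sn u k * dn u k)) u := by
  have := (hasDerivAt_am hk u).cos
  simpa [sn, cn] using this

theorem hasDerivAt_dn_sq {k : ℝ} (hk : k ^ 2 < 1) (u : ℝ) :
    HasDerivAt (fun u => dn u k ^ 2) (-(2 * k ^ 2) * (sn u k * cn u k * dn u k)) u := by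
  simp only [dn_sq hk]
  refine ((((hasDerivAt_sn hk u).pow 2).const_mul (k ^ 2)).const_sub 1).congr_deriv ?_
  simp
  ring

theorem hasDerivAt_dn {k : ℝ} (hk : k ^ 2 < 1) (u : ℝ) :
    HasDerivAt (fun u => dn u k) (-k ^ 2 * (sn u k * cn u k)) u := by
  have h := (hasDerivAt_dn_sq hk u).sqrt (pow_pos (dn_pos hk u) 2).ne'
  simp only [Real.sqrt_sq (dn_pos hk _).le] at h
  refine h.congr_deriv ?_
  have := (dn_pos hk u).ne'
  field_simp

theorem continuous_sn {k : ℝ} (hk : k ^ 2 < 1) : Continuous fun u => sn u k :=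
  Real.continuous_sin.comp (continuous_am hk)

theorem continuous_cn {k : ℝ} (hk : k ^ 2 < 1) : Continuous fun u => cn u k :=
  Real.continuous_cos.comp (continuous_am hk)

theorem continuous_dn {k : ℝ} (hk : k ^ 2 < 1) : Continuous fun u => dn u k :=
  (continuous_sqrt_one_sub k).comp (continuous_am hk)

theorem sn_add {k : ℝ} (hk : k ^ 2 < 1) (u : ℝ) : sn (u + 2 * ellipticK k) k = -sn u k := by
  simp [sn, am_add_two_mul hk]

theorem cn_add {k : ℝ} (hk : k ^ 2 < 1) (u : ℝ) : cn (u + 2 * ellipticK k) k = -cn u k := by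
  simp [cn, am_add_two_mul hk]

theorem dn_add {k : ℝ} (hk : k ^ 2 < 1) (u : ℝ) : dn (u + 2 * ellipticK k) k = dn u k := by
  simp [dn, sn_add hk]

theorem sn_neg {k : ℝ} (hk : k ^ 2 < 1) (u : ℝ) : sn (-u) k = -sn u k := by simp [sn, am_neg hk]

theorem cn_neg {k : ℝ} (hk : k ^ 2 < 1) (u : ℝ) : cn (-u) k = cn u k := by simp [cn, am_neg hk]

theorem dn_neg {k : ℝ} (hk : k ^ 2 < 1) (u : ℝ) : dn (-u) k = dn u k := by simp [dn, sn_neg hk]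

/-- Both sides vanish at `0` and have derivative `dn²`. The Legendre form supplies smoothness in `k`
and the quasi-period of `zetaJ`. -/
theorem incompleteE_eq {k : ℝ} (hk : k ^ 2 < 1) (u : ℝ) :
    incompleteE u k = legendreE k (am u k) := by
  have h1 : ∀ v, HasDerivAt (fun u => legendreE k (am u k)) (dn v k ^ 2) v := fun v => by
    refine ((hasDerivAt_legendreE k (am v k)).comp v (hasDerivAt_am hk v)).congr_deriv ?_
    rw [sq (dn v k)]
    rfl
  have h2 := intervalIntegral.integral_eq_sub_of_hasDerivAt (a := 0) (b := u) (fun v _ => h1 v)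
    (((continuous_dn hk).pow 2).intervalIntegrable _ _)
  rw [incompleteE, h2, am_zero hk]
  simp [legendreE]

theorem zetaJ_add {k : ℝ} (hk : k ^ 2 < 1) (u : ℝ) :
    zetaJ (u + 2 * ellipticK k) k = zetaJ u k := by
  have := (ellipticK_pos hk).ne'
  rw [zetaJ, zetaJ, incompleteE_eq hk, incompleteE_eq hk, am_add_two_mul hk, legendreE_add_pi]
  field_simp
  ring

theorem contDiffAt_sn {k : ℝ} (hk : k ^ 2 < 1) (u : ℝ) :
    ContDiffAt ℝ ∞ (fun x : ℝ × ℝ => sn x.1 x.2) (u, k) := (contDiffAt_am hk u).sin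

theorem contDiffAt_cn {k : ℝ} (hk : k ^ 2 < 1) (u : ℝ) :
    ContDiffAt ℝ ∞ (fun x : ℝ × ℝ => cn x.1 x.2) (u, k) := (contDiffAt_am hk u).cos

theorem contDiffAt_dn {k : ℝ} (hk : k ^ 2 < 1) (u : ℝ) :
    ContDiffAt ℝ ∞ (fun x : ℝ × ℝ => dn x.1 x.2) (u, k) :=
  (contDiffAt_const.sub ((contDiffAt_snd.pow 2).mul ((contDiffAt_sn hk u).pow 2))).sqrt
    (one_sub_sq_sin_pos hk _).ne'

theorem contDiffAt_zetaJ {k : ℝ} (hk : k ^ 2 < 1) (u : ℝ) :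
    ContDiffAt ℝ ∞ (fun x : ℝ × ℝ => zetaJ x.1 x.2) (u, k) := by
  have hn : ∀ᶠ y : ℝ × ℝ in 𝓝 (u, k), y.2 ^ 2 < 1 :=
    (isOpen_sq_lt_one.preimage continuous_snd).mem_nhds hk
  have hE : ContDiffAt ℝ ∞ (fun x : ℝ × ℝ => legendreE x.2 (am x.1 x.2)) (u, k) :=
    ContDiffAt.comp (g := fun x : ℝ × ℝ => legendreE x.1 x.2)
      (f := fun x : ℝ × ℝ => (x.2, am x.1 x.2)) (u, k)
      (contDiffOn_legendreE.contDiffAt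
        ((isOpen_sq_lt_one.prod isOpen_univ).mem_nhds ⟨hk, mem_univ _⟩))
      (contDiffAt_snd.prodMk (contDiffAt_am hk u))
  have hK1 := (contDiffOn_ellipticK.contDiffAt (isOpen_sq_lt_one.mem_nhds hk)).comp
    (f := fun x : ℝ × ℝ => x.2) (u, k) contDiffAt_snd
  have hE1 := (contDiffOn_ellipticE.contDiffAt (isOpen_sq_lt_one.mem_nhds hk)).comp
    (f := fun x : ℝ × ℝ => x.2) (u, k) contDiffAt_snd
  refine (hE.sub ((hE1.mul contDiffAt_fst).div hK1 (ellipticK_pos hk).ne')).congr_of_eventuallyEq ?_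
  filter_upwards [hn] with y hy
  simp only [zetaJ, incompleteE_eq hy, Pi.div_apply, Function.comp]

end Modulus

/-! ### Monotonicity and smooth inversion of the action, and nondegeneracy of the frequency. -/

section ActionAngle

theorem exists_hasDerivAt_integral_pos {V : Set ℝ} (hV : IsOpen V) {h : ℝ × ℝ → ℝ}
    (hh : ContDiffOn ℝ ∞ h (V ×ˢ univ)) {a b k : ℝ} (hab : a < b) (hk : k ∈ V) {h' : ℝ → ℝ}
    (hd : ∀ s, HasDerivAt (fun k => h (k, s)) (h' s) k) (hpos : ∀ s ∈ Ioo a b, 0 < h' s) :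
    ∃ d > 0, HasDerivAt (fun k => ∫ s in a..b, h (k, s)) d k := by
  have hO : IsOpen (V ×ˢ (univ : Set ℝ)) := hV.prod isOpen_univ
  have h1 := hasFDerivAt_intervalIntegral_param hV (hh.of_le (by simp)) a b hk
  have hcont : Continuous fun s => (fderiv ℝ h (k, s)).comp (ContinuousLinearMap.inl ℝ ℝ ℝ) :=
    continuous_section (g := fun y => (fderiv ℝ h y).comp (ContinuousLinearMap.inl ℝ ℝ ℝ))
      ((hh.continuousOn_fderiv_of_isOpen hO (by simp)).clm_comp continuousOn_const) hk
  have heq : ∀ s, (fderiv ℝ h (k, s)).comp (ContinuousLinearMap.inl ℝ ℝ ℝ) 1 = h' s := fun s => by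
    have h2 : HasFDerivAt h (fderiv ℝ h (k, s)) (k, s) :=
      ((hh.contDiffAt (hO.mem_nhds (mk_mem_prod hk (mem_univ s)))).differentiableAt
        (by simp)).hasFDerivAt
    exact (HasFDerivAt.comp (f := fun x => (x, s)) k h2
      (hasFDerivAt_prodMk_left k s)).hasDerivAt.unique (hd s)
  refine ⟨_, ?_, h1.hasDerivAt⟩
  rw [ContinuousLinearMap.intervalIntegral_apply (hcont.intervalIntegrable _ _)]
  simp only [heq]
  refine intervalIntegral.intervalIntegral_pos_of_pos_on ?_ hpos hab
  have : Continuous h' := by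
    have := hcont.clm_apply (continuous_const (y := (1 : ℝ)))
    simpa only [heq] using this
  exact this.intervalIntegrable _ _

theorem sq_lt_one_of_mem {k : ℝ} (hk : k ∈ Ioo (0 : ℝ) 1) : k ^ 2 < 1 := by
  nlinarith [hk.1, hk.2]

theorem hasDerivAt_sqrt_modulus {k : ℝ} (hk : k ^ 2 < 1) (s : ℝ) :
    HasDerivAt (fun k => Real.sqrt (1 - k ^ 2 * Real.sin s ^ 2))
      (-(k * Real.sin s ^ 2) / Real.sqrt (1 - k ^ 2 * Real.sin s ^ 2)) k := by
  have h := (((hasDerivAt_pow 2 k).mul_const (Real.sin s ^ 2)).const_sub 1).sqrt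
    (one_sub_sq_sin_pos hk s).ne'
  refine h.congr_deriv ?_
  have := (sqrt_one_sub_sq_sin_pos hk s).ne'
  norm_num
  field_simp

theorem exists_hasDerivAt_ellipticK {k : ℝ} (hk : k ∈ Ioo (0 : ℝ) 1) :
    ∃ d > 0, HasDerivAt ellipticK d k := by
  have hk2 := sq_lt_one_of_mem hk
  refine exists_hasDerivAt_integral_pos isOpen_sq_lt_one contDiffOn_one_div_sqrt_one_sub
    (by positivity) hk2 (h' := fun s => k * Real.sin s ^ 2
      / Real.sqrt (1 - k ^ 2 * Real.sin s ^ 2) ^ 3) (fun s => ?_) fun s hs => ?_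
  · have hp := (sqrt_one_sub_sq_sin_pos hk2 s).ne'
    refine ((hasDerivAt_const k (1 : ℝ)).div (hasDerivAt_sqrt_modulus hk2 s) hp).congr_deriv ?_
    field_simp
    ring
  · have h1 := sqrt_one_sub_sq_sin_pos hk2 s
    have h2 := Real.sin_pos_of_pos_of_lt_pi hs.1 (by linarith [hs.2, Real.pi_pos])
    have h3 := hk.1
    positivity

/-- In this form the integrand visibly increases with `k`, whereas `(k² - 1) K + E` contains terms
of opposite sign. -/
theorem action_eq_integral (α : ℝ) {k : ℝ} (hk : k ^ 2 < 1) :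
    action α k = 8 / Real.pi * Real.sqrt α *
      ∫ ψ in (0 : ℝ)..(Real.pi / 2),
        k ^ 2 * Real.cos ψ ^ 2 / Real.sqrt (1 - k ^ 2 * Real.sin ψ ^ 2) := by
  rw [action, ellipticK, ellipticE, ← intervalIntegral.integral_const_mul,
    ← intervalIntegral.integral_add]
  · congr 1
    refine intervalIntegral.integral_congr fun ψ _ => ?_
    have h1 := (sqrt_one_sub_sq_sin_pos hk ψ).ne'
    have h2 := Real.sq_sqrt (one_sub_sq_sin_pos hk ψ).le
    field_simp
    rw [h2, Real.cos_sq']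
    ring
  · exact ((continuous_one_div_sqrt_one_sub hk).const_mul _).intervalIntegrable _ _
  · exact (continuous_sqrt_one_sub k).intervalIntegrable _ _

theorem contDiffAt_action (α : ℝ) {k : ℝ} (hk : k ^ 2 < 1) : ContDiffAt ℝ ∞ (action α) k := by
  have h1 := contDiffOn_ellipticK.contDiffAt (isOpen_sq_lt_one.mem_nhds hk)
  have h2 := contDiffOn_ellipticE.contDiffAt (isOpen_sq_lt_one.mem_nhds hk)
  exact contDiffAt_const.mul ((((contDiffAt_id.pow 2).sub contDiffAt_const).mul h1).add h2)

theorem exists_hasDerivAt_action {α k : ℝ} (hα : 0 < α) (hk : k ∈ Ioo (0 : ℝ) 1) :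
    ∃ d > 0, HasDerivAt (action α) d k := by
  have hk2 := sq_lt_one_of_mem hk
  have hc : ContDiffOn ℝ ∞ (fun x : ℝ × ℝ => x.1 ^ 2 * Real.cos x.2 ^ 2
      / Real.sqrt (1 - x.1 ^ 2 * Real.sin x.2 ^ 2)) ({k : ℝ | k ^ 2 < 1} ×ˢ univ) :=
    ContDiffOn.div (by fun_prop) contDiffOn_sqrt_one_sub
      fun x hx => (sqrt_one_sub_sq_sin_pos hx.1 x.2).ne'
  have key := exists_hasDerivAt_integral_pos isOpen_sq_lt_one hc
    (show 0 < Real.pi / 2 by positivity) hk2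
    (h' := fun s => 2 * k * Real.cos s ^ 2 / Real.sqrt (1 - k ^ 2 * Real.sin s ^ 2)
      + k ^ 3 * Real.cos s ^ 2 * Real.sin s ^ 2 / Real.sqrt (1 - k ^ 2 * Real.sin s ^ 2) ^ 3)
  obtain ⟨d, hd, h⟩ := key
    (fun s => by
      have hp := (sqrt_one_sub_sq_sin_pos hk2 s).ne'
      refine (((hasDerivAt_pow 2 k).mul_const (Real.cos s ^ 2)).div
        (hasDerivAt_sqrt_modulus hk2 s) hp).congr_deriv ?_
      field_simp
      push_cast
      ring)
    (fun s hs => by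
      have h1 := sqrt_one_sub_sq_sin_pos hk2 s
      have h2 := Real.cos_pos_of_mem_Ioo (x := s) ⟨by linarith [hs.1, Real.pi_pos], hs.2⟩
      have h3 := hk.1
      positivity)
  refine ⟨8 / Real.pi * Real.sqrt α * d, by positivity, ?_⟩
  refine (h.const_mul (8 / Real.pi * Real.sqrt α)).congr_of_eventuallyEq ?_
  filter_upwards [isOpen_sq_lt_one.mem_nhds hk2] with y hy
  exact action_eq_integral α hy

theorem strictMonoOn_action {α : ℝ} (hα : 0 < α) : StrictMonoOn (action α) (Ioo 0 1) := by
  refine strictMonoOn_of_deriv_pos (convex_Ioo 0 1) (fun k hk => ?_) fun k hk => ?_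
  · obtain ⟨d, -, hd⟩ := exists_hasDerivAt_action hα hk
    exact hd.continuousAt.continuousWithinAt
  · rw [interior_Ioo] at hk
    obtain ⟨d, hd0, hd⟩ := exists_hasDerivAt_action hα hk
    rwa [hd.deriv]

theorem modulus_action {α k : ℝ} (hα : 0 < α) (hk : k ∈ Ioo (0 : ℝ) 1) :
    modulus α (action α k) = k :=
  (strictMonoOn_action hα).injOn.leftInvOn_invFunOn hk

/-- `modulus` is an inverse picked by choice. Near `action α k` it agrees with the smooth local
inverse, whose values stay in `(0, 1)`, where the action is injective. -/
theorem contDiffAt_modulus {α k : ℝ} (hα : 0 < α) (hk : k ∈ Ioo (0 : ℝ) 1) :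
    ContDiffAt ℝ ∞ (modulus α) (action α k) := by
  obtain ⟨d, hd0, hd⟩ := exists_hasDerivAt_action hα hk
  have hc := contDiffAt_action α (sq_lt_one_of_mem hk)
  have hL := hd.hasFDerivAt_equiv hd0.ne'
  have hinv := hc.to_localInverse hL (by simp)
  refine hinv.congr_of_eventuallyEq ?_
  have hright := (hc.hasStrictFDerivAt' hL (by simp)).eventually_right_inverse
  have hmem : ∀ᶠ y in 𝓝 (action α k), hc.localInverse hL (by simp) y ∈ Ioo (0 : ℝ) 1 := by
    have h1 := hinv.continuousAt
    rw [ContinuousAt, hc.localInverse_apply_image hL (by simp)] at h1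
    exact h1 (Ioo_mem_nhds hk.1 hk.2)
  filter_upwards [hright, hmem] with y hy hym
  have h2 : action α (hc.localInverse hL (by simp) y) = y := hy
  nth_rewrite 1 [← h2]
  exact modulus_action hα hym

theorem isOpen_image_action {α : ℝ} (hα : 0 < α) : IsOpen (action α '' Ioo 0 1) := by
  rw [isOpen_iff_mem_nhds]
  rintro _ ⟨k, hk, rfl⟩
  obtain ⟨d, hd0, hd⟩ := exists_hasDerivAt_action hα hk
  have hs : HasStrictDerivAt (action α) d k :=
    (contDiffAt_action α (sq_lt_one_of_mem hk)).hasStrictDerivAt' hd (by simp)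
  rw [← hs.map_nhds_eq hd0.ne']
  exact image_mem_map (Ioo_mem_nhds hk.1 hk.2)

theorem contDiffOn_modulus {α : ℝ} (hα : 0 < α) :
    ContDiffOn ℝ ∞ (modulus α) (action α '' Ioo 0 1) := by
  rintro _ ⟨k, hk, rfl⟩
  exact (contDiffAt_modulus hα hk).contDiffWithinAt

theorem modulus_mem {α I : ℝ} (hα : 0 < α) (hI : I ∈ action α '' Ioo 0 1) :
    modulus α I ∈ Ioo (0 : ℝ) 1 := by
  obtain ⟨k, hk, rfl⟩ := hI
  rwa [modulus_action hα hk]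

theorem contDiffOn_ellipticK_modulus {α : ℝ} (hα : 0 < α) :
    ContDiffOn ℝ ∞ (fun I => ellipticK (modulus α I)) (action α '' Ioo 0 1) :=
  contDiffOn_ellipticK.comp (contDiffOn_modulus hα)
    fun _ hI => sq_lt_one_of_mem (modulus_mem hα hI)

theorem contDiffOn_freq {α : ℝ} (hα : 0 < α) :
    ContDiffOn ℝ ∞ (freq α) (action α '' Ioo 0 1) :=
  contDiffOn_const.div (contDiffOn_const.mul (contDiffOn_ellipticK_modulus hα)) fun _ hI =>
    mul_ne_zero two_ne_zero (ellipticK_pos (sq_lt_one_of_mem (modulus_mem hα hI))).ne'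

theorem freq_action {α k : ℝ} (hα : 0 < α) (hk : k ∈ Ioo (0 : ℝ) 1) :
    freq α (action α k) = Real.pi * Real.sqrt α / (2 * ellipticK k) := by
  rw [freq, modulus_action hα hk]

theorem hasDerivAt_freq {α k : ℝ} (hα : 0 < α) (hk : k ∈ Ioo (0 : ℝ) 1) :
    HasDerivAt (freq α) (freqDeriv α (action α k)) (action α k) :=
  (((contDiffOn_freq hα).contDiffAt
    ((isOpen_image_action hα).mem_nhds (mem_image_of_mem _ hk))).differentiableAt
    (by simp)).hasDerivAt

/-- By the chain rule in `k`, `Ω'(I) · dI/dk = d/dk (π√α / 2K) < 0`, since `K` is increasing. -/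
theorem freqDeriv_ne_zero {α k : ℝ} (hα : 0 < α) (hk : k ∈ Ioo (0 : ℝ) 1) :
    freqDeriv α (action α k) ≠ 0 := by
  obtain ⟨d, hd0, hd⟩ := exists_hasDerivAt_action hα hk
  obtain ⟨e, he0, he⟩ := exists_hasDerivAt_ellipticK hk
  have hK := ellipticK_pos (sq_lt_one_of_mem hk)
  have h1 := (hasDerivAt_freq hα hk).comp k hd
  have h2 := (hasDerivAt_const k (Real.pi * Real.sqrt α)).div (he.const_mul 2)
    (mul_ne_zero two_ne_zero hK.ne')
  have h3 := h1.unique (h2.congr_of_eventuallyEq (by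
    filter_upwards [Ioo_mem_nhds hk.1 hk.2] with y hy
    exact freq_action hα hy))
  intro h0
  rw [h0, zero_mul, zero_mul, zero_sub, eq_comm, div_eq_zero_iff] at h3
  have : 0 < Real.pi * Real.sqrt α * (2 * e) := by positivity
  rcases h3 with h3 | h3
  · linarith
  · exact (by positivity : (2 * ellipticK k) ^ 2 ≠ 0) h3

/-! ### Smoothness and `2π`-periodicity of the perturbing fields. -/

section Fields

variable {α : ℝ}

theorem contDiffAt_comp_modulus (hα : 0 < α) {x : ℝ × ℝ × ℝ} (hx : x.2.2 ∈ action α '' Ioo 0 1)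
    {f : ℝ × ℝ → ℝ} (hf : ∀ {k : ℝ}, k ^ 2 < 1 → ∀ u, ContDiffAt ℝ ∞ f (u, k)) :
    ContDiffAt ℝ ∞ (fun y : ℝ × ℝ × ℝ =>
      f (2 * ellipticK (modulus α y.2.2) / Real.pi * y.2.1, modulus α y.2.2)) x := by
  have hn := (isOpen_image_action hα).mem_nhds hx
  have h2 : ContDiffAt ℝ ∞ (fun y : ℝ × ℝ × ℝ => y.2.2) x := by fun_prop
  have hm := ((contDiffOn_modulus hα).contDiffAt hn).comp (f := fun y : ℝ × ℝ × ℝ => y.2.2) x h2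
  have hK := ((contDiffOn_ellipticK_modulus hα).contDiffAt hn).comp
    (f := fun y : ℝ × ℝ × ℝ => y.2.2) x h2
  have h1 : ContDiffAt ℝ ∞ (fun y : ℝ × ℝ × ℝ => y.2.1) x := by fun_prop
  exact ContDiffAt.comp (g := f) (f := fun y : ℝ × ℝ × ℝ =>
      (2 * ellipticK (modulus α y.2.2) / Real.pi * y.2.1, modulus α y.2.2)) x
    (hf (sq_lt_one_of_mem (modulus_mem hα hx)) _)
    ((((contDiffAt_const.mul hK).div_const Real.pi).mul h1).prodMk hm)

theorem contDiffOn_angleField (hα : 0 < α) (C₁ τ₀ : ℝ) :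
    ContDiffOn ℝ ∞ (fun x : ℝ × ℝ × ℝ => angleField α C₁ τ₀ x.1 x.2.1 x.2.2)
      {x | x.2.2 ∈ action α '' Ioo 0 1} := by
  intro x hx
  apply ContDiffAt.contDiffWithinAt
  have hx' : x.2.2 ∈ action α '' Ioo 0 1 := hx
  have hn := (isOpen_image_action hα).mem_nhds hx'
  have h2 : ContDiffAt ℝ ∞ (fun y : ℝ × ℝ × ℝ => y.2.2) x := by fun_prop
  have hc : ContDiffAt ℝ ∞ (fun y : ℝ × ℝ × ℝ => Real.cos (y.1 - τ₀)) x := by fun_prop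
  have hm : ContDiffAt ℝ ∞ (fun y : ℝ × ℝ × ℝ => modulus α y.2.2) x :=
    ((contDiffOn_modulus hα).contDiffAt hn).comp (f := fun y : ℝ × ℝ × ℝ => y.2.2) x h2
  have hK : ContDiffAt ℝ ∞ (fun y : ℝ × ℝ × ℝ => ellipticK (modulus α y.2.2)) x :=
    ((contDiffOn_ellipticK_modulus hα).contDiffAt hn).comp (f := fun y : ℝ × ℝ × ℝ => y.2.2) x h2
  have hs := contDiffAt_comp_modulus hα hx' contDiffAt_sn
  have hcn := contDiffAt_comp_modulus hα hx' contDiffAt_cn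
  have hdn := contDiffAt_comp_modulus hα hx' contDiffAt_dn
  have hz := contDiffAt_comp_modulus hα hx' contDiffAt_zetaJ
  have hk2 := sq_lt_one_of_mem (modulus_mem hα hx')
  have hK0 : ellipticK (modulus α x.2.2) ≠ 0 := (ellipticK_pos hk2).ne'
  have hd0 := (dn_pos hk2 (2 * ellipticK (modulus α x.2.2) / Real.pi * x.2.1)).ne'
  have hk0 : 1 - modulus α x.2.2 ^ 2 ≠ 0 := by linarith
  have hα0 : Real.sqrt α ≠ 0 := (Real.sqrt_pos.2 hα).ne'
  unfold angleField
  refine ContDiffAt.add (.mul (.mul (.neg (contDiffAt_const.div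
    ((contDiffAt_const.mul hK).mul contDiffAt_const) (by simp [hK0, hα0]))) ?_) hc) ?_
  · refine ((hs.pow 2).add (.div ((hm.pow 2).mul (hs.pow 2) |>.mul (hcn.pow 2))
      (contDiffAt_const.sub (hm.pow 2)) hk0)).sub (.div ?_ (contDiffAt_const.sub (hm.pow 2)) hk0)
    exact ((hz.mul hs).mul hcn).mul hdn
  · refine .mul (.div (contDiffAt_const.mul hcn) (contDiffAt_const.mul hK) (by simp [hK0])) ?_
    refine .sub (.add (hs.div hdn hd0) (.div (.mul (.mul (hm.pow 2) hs) (hcn.pow 2))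
      (.mul (contDiffAt_const.sub (hm.pow 2)) hdn) (mul_ne_zero hk0 hd0)))
      ((hz.mul hcn).div (contDiffAt_const.sub (hm.pow 2)) hk0)

theorem contDiffOn_actionField (hα : 0 < α) (C₁ τ₀ : ℝ) :
    ContDiffOn ℝ ∞ (fun x : ℝ × ℝ × ℝ => actionField α C₁ τ₀ x.1 x.2.1 x.2.2)
      {x | x.2.2 ∈ action α '' Ioo 0 1} := by
  intro x hx
  apply ContDiffAt.contDiffWithinAt
  have hx' : x.2.2 ∈ action α '' Ioo 0 1 := hx
  have hn := (isOpen_image_action hα).mem_nhds hx'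
  have h2 : ContDiffAt ℝ ∞ (fun y : ℝ × ℝ × ℝ => y.2.2) x := by fun_prop
  have hc : ContDiffAt ℝ ∞ (fun y : ℝ × ℝ × ℝ => Real.cos (y.1 - τ₀)) x := by fun_prop
  have hm : ContDiffAt ℝ ∞ (fun y : ℝ × ℝ × ℝ => modulus α y.2.2) x :=
    ((contDiffOn_modulus hα).contDiffAt hn).comp (f := fun y : ℝ × ℝ × ℝ => y.2.2) x h2
  have hK : ContDiffAt ℝ ∞ (fun y : ℝ × ℝ × ℝ => ellipticK (modulus α y.2.2)) x :=
    ((contDiffOn_ellipticK_modulus hα).contDiffAt hn).comp (f := fun y : ℝ × ℝ × ℝ => y.2.2) x h2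
  have hs := contDiffAt_comp_modulus hα hx' contDiffAt_sn
  have hcn := contDiffAt_comp_modulus hα hx' contDiffAt_cn
  have hdn := contDiffAt_comp_modulus hα hx' contDiffAt_dn
  unfold actionField
  refine .sub (.mul (.mul (.mul (.mul ?_ hc) hs) hcn) hdn) (.mul ?_ (hcn.pow 2))
  · exact ((contDiffAt_const.mul (hm.pow 2)).mul hK).div_const _
  · exact (((contDiffAt_const.mul (hm.pow 2)).mul contDiffAt_const).mul hK).div_const _

/-- The shift is split into two half-periods `2K`, so that the sign changes of `sn` and `cn` cancel.
-/
theorem two_mul_div_pi_add (K φ : ℝ) : 2 * K / Real.pi * (φ + 2 * Real.pi)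
    = 2 * K / Real.pi * φ + 2 * K + 2 * K := by
  have := Real.pi_ne_zero
  field_simp
  ring

theorem angleField_periodic (hα : 0 < α) (C₁ τ₀ τ : ℝ) {I : ℝ} (hI : I ∈ action α '' Ioo 0 1) :
    Function.Periodic (fun φ => angleField α C₁ τ₀ τ φ I) (2 * Real.pi) := fun φ => by
  have hk := sq_lt_one_of_mem (modulus_mem hα hI)
  simp only [angleField, two_mul_div_pi_add, sn_add hk, cn_add hk, dn_add hk, zetaJ_add hk, neg_neg]

theorem actionField_periodic (hα : 0 < α) (C₁ τ₀ τ : ℝ) {I : ℝ} (hI : I ∈ action α '' Ioo 0 1) :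
    Function.Periodic (fun φ => actionField α C₁ τ₀ τ φ I) (2 * Real.pi) := fun φ => by
  have hk := sq_lt_one_of_mem (modulus_mem hα hI)
  simp only [actionField, two_mul_div_pi_add, sn_add hk, cn_add hk, dn_add hk, neg_neg]

end Fields

end ActionAngle

/-! ### Quarter-period shift and ascending Landen transformation. -/

section Landen

/-- Composition with `incompleteF k` turns this autonomous equation into one with constant slope
`c`. Amplitude identities can thus be checked through their derivatives. -/
theorem am_eq_of_hasDerivAt {k : ℝ} (hk : k ^ 2 < 1) {A : ℝ → ℝ} {c a : ℝ}
    (hA : ∀ u, HasDerivAt A (c * Real.sqrt (1 - k ^ 2 * Real.sin (A u) ^ 2)) u)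
    (h0 : incompleteF k (A 0) = a) (u : ℝ) : am (a + c * u) k = A u := by
  have hd : ∀ u, HasDerivAt (fun u => incompleteF k (A u) - c * u) 0 u := fun u => by
    refine (((hasDerivAt_incompleteF hk (A u)).comp u (hA u)).sub
      ((hasDerivAt_id u).const_mul c)).congr_deriv ?_
    have := (sqrt_one_sub_sq_sin_pos hk (A u)).ne'
    field_simp
    ring
  have hconst := is_const_of_deriv_eq_zero (fun u => (hd u).differentiableAt)
    (fun u => (hd u).deriv) u 0
  apply am_eq hk
  simp only [h0, mul_zero, sub_zero] at hconst
  linarith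

/-- The candidate for `am (u + K)` is `A = π/2 + ∫ k'/dn`. Once its sine and cosine are identified,
`A` is seen to satisfy the amplitude equation. -/
theorem am_add_ellipticK_aux {k : ℝ} (hk : k ^ 2 < 1) (u : ℝ) :
    sn (u + ellipticK k) k = cn u k / dn u k ∧
      cn (u + ellipticK k) k = -(Real.sqrt (1 - k ^ 2) * sn u k / dn u k) := by
  set k' := Real.sqrt (1 - k ^ 2) with hk'
  have hk'2 : k' ^ 2 = 1 - k ^ 2 := Real.sq_sqrt (by linarith)
  have hdn : ∀ v, dn v k ≠ 0 := fun v => (dn_pos hk v).ne'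
  have hcont : Continuous fun v => k' / dn v k :=
    continuous_const.div (continuous_dn hk) hdn
  let A : ℝ → ℝ := fun u => Real.pi / 2 + ∫ v in (0 : ℝ)..u, k' / dn v k
  have hA : ∀ v, HasDerivAt A (k' / dn v k) v := fun v =>
    (intervalIntegral.integral_hasDerivAt_right (hcont.intervalIntegrable _ _)
      (hcont.stronglyMeasurableAtFilter _ _) hcont.continuousAt).const_add _
  have hS : ∀ v, HasDerivAt (fun u => cn u k / dn u k)
      (-(k' * sn v k / dn v k) * (k' / dn v k)) v := fun v => by
    refine ((hasDerivAt_cn hk v).div (hasDerivAt_dn hk v) (hdn v)).congr_deriv ?_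
    have := hdn v
    field_simp
    linear_combination (-sn v k) * (dn_sq hk v) - k ^ 2 * sn v k * sn_sq_add_cn_sq v k
      + sn v k * (hk'2) + 2 * k ^ 2 * sn v k * sn_sq_add_cn_sq v k
  have hC : ∀ v, HasDerivAt (fun u => -(k' * sn u k / dn u k))
      (-(cn v k / dn v k * (k' / dn v k))) v := fun v => by
    refine (((hasDerivAt_sn hk v).const_mul k').div (hasDerivAt_dn hk v) (hdn v)).neg.congr_deriv ?_
    have := hdn v
    field_simp
    linear_combination (-k' * cn v k) * dn_sq hk v
  -- The unit vectors `(cn/dn, -k' sn/dn)` and `(sin A, cos A)` rotate at the same rate, so their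
  -- inner product keeps its initial value `1` and they coincide.
  have hW : ∀ v, HasDerivAt (fun u => cn u k / dn u k * Real.sin (A u)
      + -(k' * sn u k / dn u k) * Real.cos (A u)) 0 v := fun v => by
    refine (((hS v).mul (hA v).sin).add ((hC v).mul (hA v).cos)).congr_deriv ?_
    ring
  have hA0 : A 0 = Real.pi / 2 := by simp [A]
  have hW1 : ∀ v, cn v k / dn v k * Real.sin (A v)
      + -(k' * sn v k / dn v k) * Real.cos (A v) = 1 := fun v => by
    rw [is_const_of_deriv_eq_zero (fun u => (hW u).differentiableAt)
      (fun u => (hW u).deriv) v 0, hA0]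
    simp [cn, dn, sn, am_zero hk]
  have hSC : ∀ v, (cn v k / dn v k) ^ 2 + (-(k' * sn v k / dn v k)) ^ 2 = 1 := fun v => by
    have := hdn v
    field_simp
    linear_combination sn_sq_add_cn_sq v k - dn_sq hk v + sn v k ^ 2 * hk'2
  have hsin : ∀ v, Real.sin (A v) = cn v k / dn v k := fun v => by
    nlinarith [hW1 v, hSC v, Real.sin_sq_add_cos_sq (A v),
      sq_nonneg (cn v k / dn v k - Real.sin (A v)),
      sq_nonneg (-(k' * sn v k / dn v k) - Real.cos (A v))]
  have hcos : ∀ v, Real.cos (A v) = -(k' * sn v k / dn v k) := fun v => by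
    nlinarith [hW1 v, hSC v, Real.sin_sq_add_cos_sq (A v),
      sq_nonneg (cn v k / dn v k - Real.sin (A v)),
      sq_nonneg (-(k' * sn v k / dn v k) - Real.cos (A v))]
  have hAam : am (ellipticK k + 1 * u) k = A u := by
    refine am_eq_of_hasDerivAt hk (fun v => (hA v).congr_deriv ?_) (by rw [hA0]; rfl) u
    rw [one_mul, hsin, eq_comm, Real.sqrt_eq_iff_mul_self_eq (by
      have := one_sub_sq_sin_pos hk (A v)
      rw [hsin] at this
      exact this.le) (div_nonneg (Real.sqrt_nonneg _) (dn_pos hk v).le)]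
    have := hdn v
    field_simp
    linear_combination dn_sq hk v - hk'2 - k ^ 2 * sn_sq_add_cn_sq v k
  rw [one_mul, add_comm] at hAam
  constructor
  · rw [sn, hAam, hsin]
  · rw [cn, hAam, hcos]

theorem dn_add_ellipticK {k : ℝ} (hk : k ^ 2 < 1) (u : ℝ) :
    dn (u + ellipticK k) k = Real.sqrt (1 - k ^ 2) / dn u k := by
  have h1 : (Real.sqrt (1 - k ^ 2)) ^ 2 = 1 - k ^ 2 := Real.sq_sqrt (by linarith)
  have h2 := (dn_pos hk u).ne'
  have h3 : 0 ≤ Real.sqrt (1 - k ^ 2) / dn u k := div_nonneg (Real.sqrt_nonneg _) (dn_pos hk u).le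
  rw [← sq_eq_sq₀ (dn_pos hk _).le h3, dn_sq hk, (am_add_ellipticK_aux hk u).1]
  field_simp
  linear_combination dn_sq hk u - k ^ 2 * sn_sq_add_cn_sq u k - h1

/-- The ascending Landen transformation of the modulus. -/
def landen (κ : ℝ) : ℝ := 2 * Real.sqrt κ / (1 + κ)

theorem landen_sq {κ : ℝ} (hκ : κ ∈ Ioo (0 : ℝ) 1) : landen κ ^ 2 = 4 * κ / (1 + κ) ^ 2 := by
  rw [landen, div_pow, mul_pow, Real.sq_sqrt hκ.1.le]
  norm_num

theorem landen_sq_lt {κ : ℝ} (hκ : κ ∈ Ioo (0 : ℝ) 1) : landen κ ^ 2 < 1 := by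
  have h1 := hκ.1
  rw [landen_sq hκ, div_lt_one (by positivity)]
  nlinarith [hκ.2, mul_pos (sub_pos.2 hκ.2) (sub_pos.2 hκ.2)]

theorem landen_mem {κ : ℝ} (hκ : κ ∈ Ioo (0 : ℝ) 1) : landen κ ∈ Ioo (0 : ℝ) 1 := by
  have h1 := hκ.1
  have h2 : 0 < landen κ := by
    rw [landen]
    have := Real.sqrt_pos.2 h1
    positivity
  exact ⟨h2, by nlinarith [landen_sq_lt hκ]⟩

theorem sqrt_one_sub_landen_sq {κ : ℝ} (hκ : κ ∈ Ioo (0 : ℝ) 1) :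
    Real.sqrt (1 - landen κ ^ 2) = (1 - κ) / (1 + κ) := by
  have h1 := hκ.1
  have h2 := sub_pos.2 hκ.2
  rw [landen_sq hκ, Real.sqrt_eq_iff_mul_self_eq_of_pos (by positivity)]
  field_simp
  ring

/-- The right-hand side `Θ` of the first identity has `Θ' = dn + k'/dn`. Since `sin Θ = (1 + k') sn
cn / dn`, this equals `(1 + k') √(1 - κ² sin² Θ)` with `1 + k' = 2/(1 + κ)`, the amplitude equation
for `κ`. The second identity reads off `Θ'`. -/
theorem landen_am {κ : ℝ} (hκ : κ ∈ Ioo (0 : ℝ) 1) (u : ℝ) :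
    am (2 / (1 + κ) * u) κ = am u (landen κ)
      + am (u + ellipticK (landen κ)) (landen κ) - Real.pi / 2 ∧
    2 / (1 + κ) * dn (2 / (1 + κ) * u) κ
      = dn u (landen κ) + (1 - κ) / (1 + κ) / dn u (landen κ) := by
  set k := landen κ with hkdef
  have hk : k ^ 2 < 1 := landen_sq_lt hκ
  have hκ2 := sq_lt_one_of_mem hκ
  have h1κ : 0 < 1 + κ := by linarith [hκ.1]
  set k' := (1 - κ) / (1 + κ) with hk'
  have hk'0 : 0 < k' := div_pos (sub_pos.2 hκ.2) h1κ
  have hsq : Real.sqrt (1 - k ^ 2) = k' := sqrt_one_sub_landen_sq hκ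
  have hk'2 : k' ^ 2 = 1 - k ^ 2 := by rw [← hsq, Real.sq_sqrt (by linarith)]
  have hc : 2 / (1 + κ) = 1 + k' := by rw [hk']; field_simp; ring
  have hcκ : (1 + k') * κ = 1 - k' := by rw [hk']; field_simp; ring
  rw [hc]
  let Θ : ℝ → ℝ := fun u => am u k + am (u + ellipticK k) k - Real.pi / 2
  have hΘ : ∀ v, HasDerivAt Θ (dn v k + k' / dn v k) v := fun v => by
    refine (((hasDerivAt_am hk v).add
      ((hasDerivAt_am hk (v + ellipticK k)).comp_add_const v _)).sub_const _).congr_deriv ?_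
    rw [dn_add_ellipticK hk, hsq]
  have hsin : ∀ v, Real.sin (Θ v) = (1 + k') * sn v k * cn v k / dn v k := fun v => by
    have h1 : Real.sin (Θ v) = -(cn v k * cn (v + ellipticK k) k
        - sn v k * sn (v + ellipticK k) k) := by
      simp only [Θ, Real.sin_sub_pi_div_two, Real.cos_add]
      rfl
    rw [h1, (am_add_ellipticK_aux hk v).1, (am_add_ellipticK_aux hk v).2, hsq]
    ring
  have hΘ' : ∀ v, dn v k + k' / dn v k
      = (1 + k') * Real.sqrt (1 - κ ^ 2 * Real.sin (Θ v) ^ 2) := fun v => by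
    have hd := dn_pos hk v
    have hd0 := hd.ne'
    have h1 := one_sub_sq_sin_pos hκ2 (Θ v)
    rw [← sq_eq_sq₀ (by positivity) (by positivity), mul_pow, Real.sq_sqrt h1.le, hsin]
    have e1 : (1 + k') ^ 2 * (1 - κ ^ 2 * ((1 + k') * sn v k * cn v k / dn v k) ^ 2)
      = (1 + k') ^ 2 - ((1 + k') * κ) ^ 2 * (1 + k') ^ 2 * sn v k ^ 2 * cn v k ^ 2
        / dn v k ^ 2 := by ring
    have e2 : (1 - k') ^ 2 * (1 + k') ^ 2 = k ^ 2 * k ^ 2 := by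
      linear_combination (k' ^ 2 - 2 + 1 - k ^ 2) * hk'2
    have e3 : k ^ 2 * sn v k ^ 2 = 1 - dn v k ^ 2 := by linear_combination dn_sq hk v
    have e4 : k ^ 2 * cn v k ^ 2 = dn v k ^ 2 - k' ^ 2 := by
      linear_combination -(dn_sq hk v) + k ^ 2 * sn_sq_add_cn_sq v k + hk'2
    have e5 : (1 - k') ^ 2 * (1 + k') ^ 2 * sn v k ^ 2 * cn v k ^ 2
        = (1 - dn v k ^ 2) * (dn v k ^ 2 - k' ^ 2) := by
      rw [e2, ← e3, ← e4]
      ring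
    rw [e1, hcκ, e5]
    field_simp
    ring
  have hΘ0 : Θ 0 = 0 := by simp [Θ, am_zero hk, am_ellipticK hk]
  have key : ∀ v, am (0 + (1 + k') * v) κ = Θ v :=
    am_eq_of_hasDerivAt hκ2 (fun v => (hΘ v).congr_deriv (hΘ' v)) (by rw [hΘ0]; simp)
  simp only [zero_add] at key
  refine ⟨key u, ?_⟩
  rw [dn, sn, key, hΘ']

/-- At `u = K(landen κ)` the amplitude identity has right-hand side `π`, and `incompleteF κ π = 2
K(κ)`. -/
theorem ellipticK_landen {κ : ℝ} (hκ : κ ∈ Ioo (0 : ℝ) 1) :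
    ellipticK (landen κ) = (1 + κ) * ellipticK κ := by
  have hk := landen_sq_lt hκ
  have hκ2 := sq_lt_one_of_mem hκ
  have h1κ : 0 < 1 + κ := by linarith [hκ.1]
  have h := (landen_am hκ (ellipticK (landen κ))).1
  rw [am_ellipticK hk, ← two_mul, ← zero_add (2 * _), am_add_two_mul hk, am_zero hk] at h
  have h2 := incompleteF_am hκ2 (2 / (1 + κ) * ellipticK (landen κ))
  rw [h, show Real.pi / 2 + (0 + Real.pi) - Real.pi / 2 = 0 + Real.pi by ring,
    incompleteF_add_pi hκ2, incompleteF_zero] at h2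
  field_simp at h2
  linarith

/-- Fourier coefficients of `dn²`, up to normalisation. -/
def dnCoeff (n : ℕ) (k : ℝ) : ℝ :=
  ∫ u in (0 : ℝ)..(2 * ellipticK k), dn u k ^ 2 * Real.cos (n * Real.pi * u / ellipticK k)

/-- A harmonic of even index is invariant under the shift by `K`, so the integral folds to `dn²(u) +
dn²(u + K)` on `[0, K]`. Squaring the Landen identity for `dn` makes this a multiple of `dn²` of
modulus `κ` minus a constant, which is orthogonal to the cosine because `n ≥ 1`. -/
theorem dnCoeff_landen {κ : ℝ} (hκ : κ ∈ Ioo (0 : ℝ) 1) {n : ℕ} (hn : 1 ≤ n) :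
    dnCoeff (2 * n) (landen κ) = 2 / (1 + κ) * dnCoeff n κ := by
  have hk := landen_sq_lt hκ
  have hκ2 := sq_lt_one_of_mem hκ
  have h1κ : 0 < 1 + κ := by linarith [hκ.1]
  have hKK := ellipticK_landen hκ
  have hK0 := (ellipticK_pos hκ2).ne'
  set k := landen κ with hkdef
  set K := ellipticK k with hK
  have hKpos : 0 < K := ellipticK_pos hk
  have hc1 : Continuous fun u => dn u k ^ 2 * Real.cos ((2 * n : ℕ) * Real.pi * u / K) := by
    have := continuous_dn hk
    fun_prop
  have hn0 : (n : ℝ) ≠ 0 := by positivity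
  have hcos : ∫ u in (0 : ℝ)..K, Real.cos ((2 * n : ℕ) * Real.pi * u / K) = 0 := by
    have e : ∀ u, (2 * n : ℕ) * Real.pi * u / K = (2 * n * Real.pi / K) * u := fun u => by
      push_cast
      ring
    simp only [e]
    rw [intervalIntegral.integral_comp_mul_left (f := Real.cos) (by positivity), integral_cos,
      show 2 * n * Real.pi / K * K = (2 * n : ℕ) * Real.pi by push_cast; field_simp,
      Real.sin_nat_mul_pi]
    simp
  have hsplit : dnCoeff (2 * n) k = ∫ u in (0 : ℝ)..K,
      (dn u k ^ 2 + dn (u + K) k ^ 2) * Real.cos ((2 * n : ℕ) * Real.pi * u / K) := by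
    rw [dnCoeff, ← intervalIntegral.integral_add_adjacent_intervals (b := K)
      (hc1.intervalIntegrable _ _) (hc1.intervalIntegrable _ _)]
    have h2 : ∫ u in K..(2 * K), dn u k ^ 2 * Real.cos ((2 * n : ℕ) * Real.pi * u / K)
        = ∫ u in (0 : ℝ)..K, dn (u + K) k ^ 2 * Real.cos ((2 * n : ℕ) * Real.pi * u / K) := by
      have := intervalIntegral.integral_comp_add_right (a := 0) (b := K)
        (fun u => dn u k ^ 2 * Real.cos ((2 * n : ℕ) * Real.pi * u / K)) K
      rw [zero_add, ← two_mul] at this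
      rw [← this]
      refine intervalIntegral.integral_congr fun u _ => ?_
      have e : (2 * n : ℕ) * Real.pi * (u + K) / K
          = (2 * n : ℕ) * Real.pi * u / K + n * (2 * Real.pi) := by
        push_cast
        field_simp
      simp only [e, Real.cos_add_nat_mul_two_pi]
    rw [h2, ← intervalIntegral.integral_add (hc1.intervalIntegrable _ _)]
    · refine intervalIntegral.integral_congr fun u _ => ?_
      ring
    · have := continuous_dn hk
      exact Continuous.intervalIntegrable (by fun_prop) _ _
  have hL : ∀ u, dn u k ^ 2 + dn (u + K) k ^ 2
      = (2 / (1 + κ)) ^ 2 * dn (2 / (1 + κ) * u) κ ^ 2 - 2 * ((1 - κ) / (1 + κ)) := fun u => by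
    have := (dn_pos hk u).ne'
    have h2 := (landen_am hκ u).2
    rw [← hkdef] at h2
    rw [← mul_pow, h2, dn_add_ellipticK hk, sqrt_one_sub_landen_sq hκ]
    field_simp
    ring
  have hc2 : Continuous fun v => dn v κ ^ 2 * Real.cos (n * Real.pi * v / ellipticK κ) := by
    have := continuous_dn hκ2
    fun_prop
  have hc3 : Continuous fun u => dn (2 / (1 + κ) * u) κ ^ 2
      * Real.cos (n * Real.pi * (2 / (1 + κ) * u) / ellipticK κ) :=
    hc2.comp (g := fun v => dn v κ ^ 2 * Real.cos (n * Real.pi * v / ellipticK κ))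
      (f := fun u => 2 / (1 + κ) * u) (by fun_prop)
  rw [hsplit]
  have hint : ∀ u, (dn u k ^ 2 + dn (u + K) k ^ 2) * Real.cos ((2 * n : ℕ) * Real.pi * u / K)
      = (2 / (1 + κ)) ^ 2 * (dn (2 / (1 + κ) * u) κ ^ 2
        * Real.cos (n * Real.pi * (2 / (1 + κ) * u) / ellipticK κ))
        - 2 * ((1 - κ) / (1 + κ)) * Real.cos ((2 * n : ℕ) * Real.pi * u / K) := fun u => by
    have e : n * Real.pi * (2 / (1 + κ) * u) / ellipticK κ = (2 * n : ℕ) * Real.pi * u / K := by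
      rw [hKK]
      push_cast
      field_simp
    rw [hL, e]
    ring
  simp only [hint]
  rw [intervalIntegral.integral_sub ((hc3.const_mul _).intervalIntegrable _ _)
    (Continuous.intervalIntegrable (by fun_prop) _ _),
    intervalIntegral.integral_const_mul, intervalIntegral.integral_const_mul, hcos,
    intervalIntegral.integral_comp_mul_left
      (f := fun v => dn v κ ^ 2 * Real.cos (n * Real.pi * v / ellipticK κ)) (by positivity),
    hKK, mul_zero, show 2 / (1 + κ) * ((1 + κ) * ellipticK κ) = 2 * ellipticK κ by field_simp,
    dnCoeff, smul_eq_mul]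
  field_simp
  ring

/-- The substitution `u = incompleteF k θ` gives an interval independent of `k`, as needed for the
limit `k → 1`, where `K` diverges. -/
theorem dnCoeff_eq {k : ℝ} (hk : k ^ 2 < 1) (n : ℕ) :
    dnCoeff n k = ∫ θ in (-(Real.pi / 2))..(Real.pi / 2),
      Real.sqrt (1 - k ^ 2 * Real.sin θ ^ 2)
        * Real.cos (n * Real.pi / ellipticK k * incompleteF k θ) := by
  have hK := (ellipticK_pos hk).ne'
  set f : ℝ → ℝ := fun u => dn u k ^ 2 * Real.cos (n * Real.pi * u / ellipticK k) with hf
  have hfc : Continuous f := by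
    have := continuous_dn hk
    fun_prop
  have hper : Function.Periodic f (2 * ellipticK k) := fun u => by
    have e : n * Real.pi * (u + 2 * ellipticK k) / ellipticK k
        = n * Real.pi * u / ellipticK k + n * (2 * Real.pi) := by
      field_simp
    simp only [hf, dn_add hk, e, Real.cos_add_nat_mul_two_pi]
  have h1 : dnCoeff n k = ∫ u in (-ellipticK k)..(ellipticK k), f u := by
    have := hper.intervalIntegral_add_eq 0 (-ellipticK k)
    rw [zero_add, show -ellipticK k + 2 * ellipticK k = ellipticK k by ring] at this
    exact this
  have h2 := intervalIntegral.integral_comp_mul_deriv (a := -(Real.pi / 2)) (b := Real.pi / 2)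
    (fun θ _ => hasDerivAt_incompleteF hk θ)
    (continuous_one_div_sqrt_one_sub hk).continuousOn hfc
  rw [incompleteF_neg, incompleteF_pi_div_two] at h2
  rw [h1, ← h2]
  refine intervalIntegral.integral_congr fun θ _ => ?_
  have hp := (sqrt_one_sub_sq_sin_pos hk θ).ne'
  simp only [hf, Function.comp, dn, sn, am_incompleteF hk]
  rw [show n * Real.pi * incompleteF k θ / ellipticK k
    = n * Real.pi / ellipticK k * incompleteF k θ by ring]
  field_simp

end Landen

/-! ### The limit of modulus 1 and positivity of the Fourier coefficients of `dn²`. -/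

section FourierPositivity

/-- The inverse Gudermannian function, the limit of `incompleteF k` as `k → 1`. -/
def invGd (θ : ℝ) : ℝ := Real.log ((1 + Real.sin θ) / 2 / (1 - (1 + Real.sin θ) / 2)) / 2

theorem abs_sin_lt_one {θ : ℝ} (hθ : θ ∈ Ioo (-(Real.pi / 2)) (Real.pi / 2)) :
    -1 < Real.sin θ ∧ Real.sin θ < 1 := by
  have h := Real.cos_pos_of_mem_Ioo hθ
  constructor <;> nlinarith [Real.sin_sq_add_cos_sq θ]

theorem hasDerivAt_invGd {θ : ℝ} (hθ : θ ∈ Ioo (-(Real.pi / 2)) (Real.pi / 2)) :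
    HasDerivAt invGd (1 / Real.cos θ) θ := by
  obtain ⟨h1, h2⟩ := abs_sin_lt_one hθ
  have hc := (Real.cos_pos_of_mem_Ioo hθ).ne'
  have hx : HasDerivAt (fun θ => (1 + Real.sin θ) / 2) (Real.cos θ / 2) θ :=
    ((Real.hasDerivAt_sin θ).const_add 1).div_const 2
  have h3 : 1 - (1 + Real.sin θ) / 2 ≠ 0 := by linarith
  have h4 : (1 + Real.sin θ) / 2 ≠ 0 := by linarith
  refine (((hx.div (hx.const_sub 1) h3).log (div_ne_zero h4 h3)).div_const 2).congr_deriv ?_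
  have h5 : 1 + Real.sin θ ≠ 0 := by linarith
  have h6 : 1 - Real.sin θ ≠ 0 := by linarith
  have e : 1 - (1 + Real.sin θ) / 2 = (1 - Real.sin θ) / 2 := by ring
  simp only [Pi.div_apply, e]
  field_simp
  nlinarith [Real.sin_sq_add_cos_sq θ]

theorem invGd_zero : invGd 0 = 0 := by norm_num [invGd]

theorem tendsto_incompleteF {κ : ℕ → ℝ} (hκ : ∀ N, κ N ∈ Ioo (0 : ℝ) 1)
    (hlim : Tendsto κ atTop (𝓝 1)) {θ : ℝ} (hθ : θ ∈ Ioo (-(Real.pi / 2)) (Real.pi / 2)) :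
    Tendsto (fun N => incompleteF (κ N) θ) atTop (𝓝 (invGd θ)) := by
  have hcosθ := Real.cos_pos_of_mem_Ioo hθ
  have hsub : ∀ ψ ∈ uIcc 0 θ, ψ ∈ Ioo (-(Real.pi / 2)) (Real.pi / 2) := fun ψ hψ =>
    (ordConnected_Ioo.uIcc_subset ⟨by linarith [Real.pi_pos], by linarith [Real.pi_pos]⟩ hθ) hψ
  have hcos : ∀ ψ ∈ uIcc 0 θ, Real.cos θ ≤ Real.cos ψ := fun ψ hψ => by
    rw [← Real.cos_abs θ, ← Real.cos_abs ψ]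
    have h1 : |ψ| ≤ |θ| := by simpa using abs_sub_left_of_mem_uIcc hψ
    exact Real.cos_le_cos_of_nonneg_of_le_pi (abs_nonneg _)
      (by have := abs_lt.2 ⟨hθ.1, hθ.2⟩; linarith [Real.pi_pos]) h1
  have hI : ∫ ψ in (0 : ℝ)..θ, 1 / Real.cos ψ = invGd θ := by
    rw [intervalIntegral.integral_eq_sub_of_hasDerivAt
      (fun ψ hψ => hasDerivAt_invGd (hsub ψ hψ)), invGd_zero, sub_zero]
    apply ContinuousOn.intervalIntegrable
    exact continuousOn_const.div Real.continuous_cos.continuousOn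
      fun ψ hψ => (Real.cos_pos_of_mem_Ioo (hsub ψ hψ)).ne'
  rw [← hI]
  refine intervalIntegral.tendsto_integral_filter_of_dominated_convergence
    (fun _ => 1 / Real.cos θ) ?_ ?_ intervalIntegrable_const ?_
  · exact .of_forall fun N =>
      (continuous_one_div_sqrt_one_sub (sq_lt_one_of_mem (hκ N))).aestronglyMeasurable
  · refine .of_forall fun N => .of_forall fun ψ hψ => ?_
    have hψ' := uIoc_subset_uIcc hψ
    have hk2 := sq_lt_one_of_mem (hκ N)
    have hp := sqrt_one_sub_sq_sin_pos hk2 ψ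
    rw [Real.norm_of_nonneg (one_div_nonneg.2 hp.le)]
    refine one_div_le_one_div_of_le hcosθ ((hcos ψ hψ').trans (Real.le_sqrt_of_sq_le ?_))
    rw [Real.cos_sq']
    nlinarith [sq_nonneg (Real.sin ψ)]
  · refine .of_forall fun ψ hψ => ?_
    have hc := Real.cos_pos_of_mem_Ioo (hsub ψ (uIoc_subset_uIcc hψ))
    have h1 : Tendsto (fun N => Real.sqrt (1 - κ N ^ 2 * Real.sin ψ ^ 2)) atTop
        (𝓝 (Real.sqrt (1 - 1 ^ 2 * Real.sin ψ ^ 2))) :=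
      (((hlim.pow 2).mul_const _).const_sub 1).sqrt
    rw [one_pow, one_mul, ← Real.cos_sq', Real.sqrt_sq hc.le] at h1
    exact tendsto_const_nhds.div h1 hc.ne'

theorem tendsto_integral_sqrt_mul_cos {κ ν : ℕ → ℝ} (hκ : ∀ N, κ N ∈ Ioo (0 : ℝ) 1)
    (hlim : Tendsto κ atTop (𝓝 1)) {ν₀ : ℝ} (hν : Tendsto ν atTop (𝓝 ν₀)) :
    Tendsto (fun N => ∫ θ in (-(Real.pi / 2))..(Real.pi / 2),
      Real.sqrt (1 - κ N ^ 2 * Real.sin θ ^ 2) * Real.cos (ν N * incompleteF (κ N) θ)) atTop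
      (𝓝 (∫ θ in (-(Real.pi / 2))..(Real.pi / 2), Real.cos θ * Real.cos (ν₀ * invGd θ))) := by
  refine intervalIntegral.tendsto_integral_filter_of_dominated_convergence
    (fun _ => 1) ?_ ?_ intervalIntegrable_const ?_
  · refine .of_forall fun N => Continuous.aestronglyMeasurable ?_
    have := continuous_incompleteF (sq_lt_one_of_mem (hκ N))
    fun_prop
  · refine .of_forall fun N => .of_forall fun θ _ => ?_
    rw [norm_mul]
    refine mul_le_one₀ ?_ (norm_nonneg _) (Real.abs_cos_le_one _)
    rw [Real.norm_of_nonneg (Real.sqrt_nonneg _), Real.sqrt_le_one]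
    nlinarith [mul_nonneg (sq_nonneg (κ N)) (sq_nonneg (Real.sin θ))]
  · have hne : ∀ᵐ θ : ℝ, θ ≠ Real.pi / 2 := by
      simp [ae_iff, measure_singleton]
    filter_upwards [hne] with θ hθ hmem
    rw [uIoc_of_le (by linarith [Real.pi_pos])] at hmem
    have hθ' : θ ∈ Ioo (-(Real.pi / 2)) (Real.pi / 2) := ⟨hmem.1, lt_of_le_of_ne hmem.2 hθ⟩
    have hc := Real.cos_pos_of_mem_Ioo hθ'
    have h1 : Tendsto (fun N => Real.sqrt (1 - κ N ^ 2 * Real.sin θ ^ 2)) atTop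
        (𝓝 (Real.sqrt (1 - 1 ^ 2 * Real.sin θ ^ 2))) :=
      (((hlim.pow 2).mul_const _).const_sub 1).sqrt
    rw [one_pow, one_mul, ← Real.cos_sq', Real.sqrt_sq hc.le] at h1
    exact h1.mul ((Real.continuous_cos.tendsto _).comp (hν.mul (tendsto_incompleteF hκ hlim hθ')))

/-- With `z = 1 + iν/2`, the integral is the real part of `B(z, z̄) = Γ(z) Γ(z̄) / Γ(2) = |Γ(z)|²`,
and `Γ` has no zeros. -/
theorem integral_cos_log_pos (ν : ℝ) :
    0 < ∫ x in (0 : ℝ)..1, Real.cos (ν * (Real.log (x / (1 - x)) / 2)) := by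
  set z : ℂ := 1 + (ν / 2 : ℝ) * Complex.I with hz
  have hzre : z.re = 1 := by simp [hz]
  have hw : (starRingEnd ℂ) z = 1 - (ν / 2 : ℝ) * Complex.I := by
    rw [hz, map_add, map_mul, Complex.conj_ofReal, Complex.conj_I, map_one]
    ring
  have hB := Complex.Gamma_mul_Gamma_eq_betaIntegral (s := z) (t := (starRingEnd ℂ) z)
    (by rw [hzre]; norm_num) (by rw [Complex.conj_re, hzre]; norm_num)
  have hsum : z + (starRingEnd ℂ) z = 2 := by
    rw [hw, hz]
    ring
  rw [Complex.Gamma_conj, Complex.mul_conj, hsum, show (2 : ℂ) = 1 + 1 by norm_num,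
    Complex.Gamma_add_one 1 one_ne_zero, Complex.Gamma_one, one_mul, one_mul] at hB
  have hconv := Complex.betaIntegral_convergent (u := z) (v := (starRingEnd ℂ) z)
    (by rw [hzre]; norm_num) (by rw [Complex.conj_re, hzre]; norm_num)
  have hre : (Complex.betaIntegral z ((starRingEnd ℂ) z)).re
      = ∫ x in (0 : ℝ)..1, Real.cos (ν * (Real.log (x / (1 - x)) / 2)) := by
    rw [Complex.betaIntegral]
    have h1 : (∫ x in (0 : ℝ)..1, (x : ℂ) ^ (z - 1) * (1 - (x : ℂ)) ^ ((starRingEnd ℂ) z - 1)).re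
        = ∫ x in (0 : ℝ)..1,
          ((x : ℂ) ^ (z - 1) * (1 - (x : ℂ)) ^ ((starRingEnd ℂ) z - 1)).re :=
      (Complex.reCLM.intervalIntegral_comp_comm hconv).symm
    rw [h1]
    refine intervalIntegral.integral_congr_ae ?_
    have hne : ∀ᵐ θ : ℝ, θ ≠ 1 := by
      simp [ae_iff, measure_singleton]
    filter_upwards [hne] with x hx hmem
    rw [uIoc_of_le zero_le_one] at hmem
    have hx0 : 0 < x := hmem.1
    have hx1 : 0 < 1 - x := sub_pos.2 (lt_of_le_of_ne hmem.2 hx)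
    have hxc : (x : ℂ) ≠ 0 := by exact_mod_cast hx0.ne'
    have e1 : (1 - (x : ℂ)) = ((1 - x : ℝ) : ℂ) := by push_cast; ring
    have hxc1 : ((1 - x : ℝ) : ℂ) ≠ 0 := by exact_mod_cast hx1.ne'
    rw [e1, Complex.cpow_def_of_ne_zero hxc, Complex.cpow_def_of_ne_zero hxc1, ← Complex.exp_add,
      ← Complex.ofReal_log hx0.le, ← Complex.ofReal_log hx1.le, hw, hz,
      Real.log_div hx0.ne' hx1.ne']
    have e2 : (Real.log x : ℂ) * (1 + (ν / 2 : ℝ) * Complex.I - 1)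
        + (Real.log (1 - x) : ℂ) * (1 - (ν / 2 : ℝ) * Complex.I - 1)
        = ((ν * ((Real.log x - Real.log (1 - x)) / 2) : ℝ) : ℂ) * Complex.I := by
      push_cast
      ring
    rw [e2, Complex.exp_ofReal_mul_I_re]
  rw [← hre, ← hB, Complex.ofReal_re, Complex.normSq_pos]
  exact Complex.Gamma_ne_zero_of_re_pos (by rw [hzre]; norm_num)

/-- Substituting `x = (1 + sin θ)/2` reduces this to the Beta integral; `invGd` is written with that
substitution in view. -/
theorem integral_cos_mul_cos_invGd_pos (ν : ℝ) :
    0 < ∫ θ in (-(Real.pi / 2))..(Real.pi / 2), Real.cos θ * Real.cos (ν * invGd θ) := by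
  set g : ℝ → ℝ := fun x => Real.cos (ν * (Real.log (x / (1 - x)) / 2)) with hg
  have hgm : Measurable g := by fun_prop
  have hgb : ∀ x, ‖g x‖ ≤ 1 := fun x => Real.abs_cos_le_one _
  have hle : -(Real.pi / 2) ≤ Real.pi / 2 := by linarith [Real.pi_pos]
  set f : ℝ → ℝ := fun θ => (1 + Real.sin θ) / 2 with hf
  have hfc : Continuous f := by fun_prop
  have hfd : ∀ θ, HasDerivAt f (Real.cos θ / 2) θ := fun θ =>
    ((Real.hasDerivAt_sin θ).const_add 1).div_const 2
  have hcompact : IsCompact (f '' uIcc (-(Real.pi / 2)) (Real.pi / 2)) :=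
    isCompact_uIcc.image hfc
  have h := intervalIntegral.integral_comp_mul_deriv''' (a := -(Real.pi / 2)) (b := Real.pi / 2)
    (f := f) (f' := fun θ => Real.cos θ / 2) (g := g) hfc.continuousOn
    (fun θ _ => (hfd θ).hasDerivWithinAt) ?_ ?_ ?_
  · have e0 : f (-(Real.pi / 2)) = 0 := by simp [hf]
    have e1 : f (Real.pi / 2) = 1 := by simp [hf]
    rw [e0, e1] at h
    have hpos := integral_cos_log_pos ν
    rw [← h] at hpos
    have e2 : ∀ θ, Real.cos θ * Real.cos (ν * invGd θ) = 2 * ((g ∘ f) θ * (Real.cos θ / 2)) :=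
      fun θ => by
        simp only [hg, hf, Function.comp, invGd]
        ring
    simp only [e2]
    rw [intervalIntegral.integral_const_mul]
    positivity
  · rintro _ ⟨θ, hθ, rfl⟩
    rw [min_eq_left hle, max_eq_right hle] at hθ
    obtain ⟨h1, h2⟩ := abs_sin_lt_one hθ
    have h3 : 1 - f θ ≠ 0 := by simp only [hf]; linarith
    have h4 : f θ ≠ 0 := by simp only [hf]; linarith
    apply ContinuousAt.continuousWithinAt
    have hdiv : ContinuousAt (fun x : ℝ => x / (1 - x)) (f θ) :=
      continuousAt_id.div (by fun_prop) h3
    have hlog := hdiv.log (div_ne_zero h4 h3)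
    exact Real.continuous_cos.continuousAt.comp ((hlog.div_const 2).const_mul ν)
  · exact Measure.integrableOn_of_bounded hcompact.measure_lt_top.ne
      hgm.aestronglyMeasurable (.of_forall hgb)
  · refine Measure.integrableOn_of_bounded (M := 1) isCompact_uIcc.measure_lt_top.ne
      (by fun_prop) (.of_forall fun θ => ?_)
    rw [norm_mul]
    refine mul_le_one₀ (hgb _) (norm_nonneg _) ?_
    rw [norm_div, Real.norm_eq_abs, Real.norm_two]
    linarith [Real.abs_cos_le_one θ]

/-- Iterated ascending Landen transformation. -/
def landenSeq (κ : ℝ) (N : ℕ) : ℝ := landen^[N] κ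

theorem landenSeq_succ (κ : ℝ) (N : ℕ) : landenSeq κ (N + 1) = landen (landenSeq κ N) :=
  Function.iterate_succ_apply' _ _ _

theorem landenSeq_mem {κ : ℝ} (hκ : κ ∈ Ioo (0 : ℝ) 1) (N : ℕ) :
    landenSeq κ N ∈ Ioo (0 : ℝ) 1 := by
  induction N with
  | zero => exact hκ
  | succ N ih =>
    rw [landenSeq_succ]
    exact landen_mem ih

theorem le_landen {κ : ℝ} (hκ : κ ∈ Ioo (0 : ℝ) 1) : κ ≤ landen κ := by
  have h0 := hκ.1
  rw [landen, le_div_iff₀ (by linarith)]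
  have h1 : κ ≤ Real.sqrt κ := Real.le_sqrt_of_sq_le (by nlinarith [hκ.2])
  nlinarith [hκ.2]

theorem le_landenSeq {κ : ℝ} (hκ : κ ∈ Ioo (0 : ℝ) 1) (N : ℕ) : κ ≤ landenSeq κ N := by
  induction N with
  | zero => exact le_rfl
  | succ N ih =>
    rw [landenSeq_succ]
    exact ih.trans (le_landen (landenSeq_mem hκ N))

theorem one_sub_landenSeq_le {κ : ℝ} (hκ : κ ∈ Ioo (0 : ℝ) 1) (N : ℕ) :
    1 - landenSeq κ N ≤ (1 - κ) ^ N := by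
  induction N with
  | zero => simpa [landenSeq] using hκ.1.le
  | succ N ih =>
    rw [landenSeq_succ, pow_succ]
    have hm := landenSeq_mem hκ N
    have hle := le_landenSeq hκ N
    set x := landenSeq κ N
    have hx := hm.1
    have h1 : x ≤ Real.sqrt x := Real.le_sqrt_of_sq_le (by nlinarith [hm.2])
    have h2 : Real.sqrt x ≤ 1 := Real.sqrt_le_one.2 hm.2.le
    have h3 : 1 - landen x = (1 - Real.sqrt x) ^ 2 / (1 + x) := by
      rw [landen, eq_div_iff (by positivity), sub_mul, div_mul_cancel₀ _ (by positivity)]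
      have := Real.sq_sqrt hx.le
      nlinarith
    have h4 : (1 - Real.sqrt x) ^ 2 / (1 + x) ≤ (1 - Real.sqrt x) ^ 2 :=
      div_le_self (sq_nonneg _) (by linarith)
    -- Since `√x ≥ x ≥ κ`, one factor is bounded by `1 - x` and the other by `1 - κ`. Geometric
    -- decay is enough here.
    have h5 : (1 - Real.sqrt x) ^ 2 ≤ (1 - x) * (1 - κ) := by
      rw [sq]
      exact mul_le_mul (by linarith) (by linarith) (by linarith) (by linarith [hm.2])
    have h6 : (1 - x) * (1 - κ) ≤ (1 - κ) ^ N * (1 - κ) :=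
      mul_le_mul_of_nonneg_right ih (by linarith [hκ.2])
    linarith

theorem tendsto_landenSeq {κ : ℝ} (hκ : κ ∈ Ioo (0 : ℝ) 1) :
    Tendsto (landenSeq κ) atTop (𝓝 1) := by
  have h1 : Tendsto (fun N => 1 - (1 - κ) ^ N) atTop (𝓝 (1 - 0)) :=
    (tendsto_pow_atTop_nhds_zero_of_lt_one (by linarith [hκ.2]) (by linarith [hκ.1])).const_sub 1
  rw [sub_zero] at h1
  exact tendsto_of_tendsto_of_tendsto_of_le_of_le h1 tendsto_const_nhds
    (fun N => by linarith [one_sub_landenSeq_le hκ N]) (fun N => (landenSeq_mem hκ N).2.le)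

/-- The sequence increases by factors `2/(1 + κ_N)`, while its quotient by `√κ_N` decreases and
bounds it. The value of the limit is irrelevant, because the limiting integral is positive at every
frequency. -/
theorem exists_tendsto_two_pow_div_ellipticK {κ : ℝ} (hκ : κ ∈ Ioo (0 : ℝ) 1) :
    ∃ L, Tendsto (fun N => 2 ^ N / ellipticK (landenSeq κ N)) atTop (𝓝 L) := by
  set a : ℕ → ℝ := fun N => 2 ^ N / ellipticK (landenSeq κ N) with ha
  have hKpos : ∀ N, 0 < ellipticK (landenSeq κ N) := fun N =>
    ellipticK_pos (sq_lt_one_of_mem (landenSeq_mem hκ N))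
  have hapos : ∀ N, 0 < a N := fun N => div_pos (by positivity) (hKpos N)
  have hstep : ∀ N, a (N + 1) = a N * (2 / (1 + landenSeq κ N)) := fun N => by
    have h1 := (hKpos N).ne'
    have h2 := (landenSeq_mem hκ N).1
    simp only [ha, landenSeq_succ, ellipticK_landen (landenSeq_mem hκ N), pow_succ]
    field_simp
  have hmono : Monotone a := monotone_nat_of_le_succ fun N => by
    have h2 := landenSeq_mem hκ N
    rw [hstep]
    refine le_mul_of_one_le_right (hapos N).le ?_
    rw [one_le_div (by linarith [h2.1])]
    linarith [h2.2]
  have hanti : Antitone fun N => a N / Real.sqrt (landenSeq κ N) :=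
    antitone_nat_of_succ_le fun N => by
      have h2 := landenSeq_mem hκ N
      have h3 := landen_mem h2
      have hs1 := Real.sqrt_pos.2 h2.1
      have hs2 := Real.sqrt_pos.2 h3.1
      have h5 : landen (landenSeq κ N) ≤ Real.sqrt (landen (landenSeq κ N)) :=
        Real.le_sqrt_of_sq_le (by nlinarith [h3.1, h3.2])
      -- The growth factor times `√κ_N` is `κ_{N+1}`, which is at most `√κ_{N+1}`.
      have h6 : 2 / (1 + landenSeq κ N) * Real.sqrt (landenSeq κ N) = landen (landenSeq κ N) := by
        rw [landen]
        ring
      rw [landenSeq_succ, hstep, div_le_div_iff₀ hs2 hs1, mul_assoc, h6]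
      exact mul_le_mul_of_nonneg_left h5 (hapos N).le
  have hbdd : BddAbove (range a) := by
    refine ⟨a 0 / Real.sqrt (landenSeq κ 0), ?_⟩
    rintro _ ⟨N, rfl⟩
    refine le_trans ?_ (hanti (Nat.zero_le N))
    have h2 := landenSeq_mem hκ N
    rw [le_div_iff₀ (Real.sqrt_pos.2 h2.1)]
    exact mul_le_of_le_one_right (hapos N).le (Real.sqrt_le_one.2 h2.2.le)
  exact ⟨_, tendsto_atTop_ciSup hmono hbdd⟩

theorem dnCoeff_landenSeq_pos_iff {κ : ℝ} (hκ : κ ∈ Ioo (0 : ℝ) 1) {n : ℕ} (hn : 1 ≤ n) (N : ℕ) :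
    0 < dnCoeff (2 ^ N * n) (landenSeq κ N) ↔ 0 < dnCoeff n κ := by
  induction N with
  | zero => simp [landenSeq]
  | succ N ih =>
    have hm := landenSeq_mem hκ N
    have hc : 0 < 2 / (1 + landenSeq κ N) := div_pos two_pos (by linarith [hm.1])
    rw [landenSeq_succ, pow_succ', mul_assoc, dnCoeff_landen hm (Nat.mul_pos (by positivity) hn),
      mul_pos_iff_of_pos_left hc, ih]

theorem dnCoeff_pos {κ : ℝ} (hκ : κ ∈ Ioo (0 : ℝ) 1) {n : ℕ} (hn : 1 ≤ n) : 0 < dnCoeff n κ := by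
  obtain ⟨L, hL⟩ := exists_tendsto_two_pow_div_ellipticK hκ
  have h := tendsto_integral_sqrt_mul_cos (landenSeq_mem hκ) (tendsto_landenSeq hκ)
    (hL.const_mul (n * Real.pi))
  obtain ⟨N, hN⟩ := (h.eventually (lt_mem_nhds (integral_cos_mul_cos_invGd_pos _))).exists
  rw [← dnCoeff_landenSeq_pos_iff hκ hn N,
    dnCoeff_eq (sq_lt_one_of_mem (landenSeq_mem hκ N))]
  have e : ((2 ^ N * n : ℕ) : ℝ) * Real.pi / ellipticK (landenSeq κ N)
      = n * Real.pi * (2 ^ N / ellipticK (landenSeq κ N)) := by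
    push_cast
    ring
  rwa [e]

end FourierPositivity

/-! ### Averages along the resonant orbit and the threshold constant. -/

section Averages

theorem integral_periodic_nat_mul {f : ℝ → ℝ} {P : ℝ} (hf : Function.Periodic f P)
    (hc : Continuous f) (n : ℕ) : ∫ x in (0 : ℝ)..(n * P), f x = n * ∫ x in (0 : ℝ)..P, f x := by
  have := hf.intervalIntegral_add_zsmul_eq n 0 (fun a b => hc.intervalIntegrable a b)
  simpa using this

theorem integral_eq_zero_of_odd_of_periodic {f : ℝ → ℝ} {T : ℝ} (hf : Function.Periodic f T)
    (hodd : ∀ x, f (-x) = -f x) : ∫ x in (0 : ℝ)..T, f x = 0 := by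
  have h1 := hf.intervalIntegral_add_eq 0 (-(T / 2))
  rw [zero_add, show -(T / 2) + T = T / 2 by ring] at h1
  have h2 := intervalIntegral.integral_comp_neg (a := -(T / 2)) (b := T / 2) f
  simp only [hodd, neg_neg, intervalIntegral.integral_neg] at h2
  rw [h1]
  linarith

/-- The product `sn cn dn`. -/
def scd (u k : ℝ) : ℝ := sn u k * cn u k * dn u k

theorem continuous_scd {k : ℝ} (hk : k ^ 2 < 1) : Continuous fun u => scd u k :=
  ((continuous_sn hk).mul (continuous_cn hk)).mul (continuous_dn hk)

theorem scd_periodic {k : ℝ} (hk : k ^ 2 < 1) :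
    Function.Periodic (fun u => scd u k) (2 * ellipticK k) := fun u => by
  simp [scd, sn_add hk, cn_add hk, dn_add hk]

theorem scd_neg {k : ℝ} (hk : k ^ 2 < 1) (u : ℝ) : scd (-u) k = -scd u k := by
  simp [scd, sn_neg hk, cn_neg hk, dn_neg hk]

/-- The derivative of `sn cn dn`. -/
def scdDeriv (u k : ℝ) : ℝ :=
  cn u k ^ 2 * dn u k ^ 2 - sn u k ^ 2 * dn u k ^ 2 - k ^ 2 * sn u k ^ 2 * cn u k ^ 2

theorem hasDerivAt_scd {k : ℝ} (hk : k ^ 2 < 1) (u : ℝ) :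
    HasDerivAt (fun u => scd u k) (scdDeriv u k) u := by
  refine (((hasDerivAt_sn hk u).mul (hasDerivAt_cn hk u)).mul (hasDerivAt_dn hk u)).congr_deriv ?_
  rw [scdDeriv]
  simp only [Pi.mul_apply]
  ring

theorem periodic_comp_mul {f : ℝ → ℝ} {P s : ℝ} (hf : Function.Periodic f P) (hs : s ≠ 0) :
    Function.Periodic (fun τ => f (s * τ)) (P / s) := fun τ => by
  have : s * (τ + P / s) = s * τ + P := by field_simp
  simp only [this, hf _]

/-- The data of a `p : q` resonance. -/
structure Resonance (α k : ℝ) (p q : ℕ) (T : ℝ) : Prop where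
  α_pos : 0 < α
  k_mem : k ∈ Ioo (0 : ℝ) 1
  p_pos : 0 < p
  q_pos : 0 < q
  T_eq : T = 2 * Real.pi * q
  res : 2 * Real.pi * q = 4 * ellipticK k * p / Real.sqrt α

namespace Resonance

variable {α k T : ℝ} {p q : ℕ}

theorem sq_lt (h : Resonance α k p q T) : k ^ 2 < 1 := sq_lt_one_of_mem h.k_mem

theorem sqrt_pos (h : Resonance α k p q T) : 0 < Real.sqrt α := Real.sqrt_pos.2 h.α_pos

theorem T_pos (h : Resonance α k p q T) : 0 < T := by
  have : (0 : ℝ) < q := by exact_mod_cast h.q_pos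
  rw [h.T_eq]
  positivity

theorem K_pos (h : Resonance α k p q T) : 0 < ellipticK k := ellipticK_pos h.sq_lt

theorem T_eq_mul (h : Resonance α k p q T) :
    T = (2 * p : ℕ) * (2 * ellipticK k / Real.sqrt α) := by
  have := h.sqrt_pos.ne'
  rw [h.T_eq, h.res]
  push_cast
  ring

theorem scd_comp_periodic (h : Resonance α k p q T) :
    Function.Periodic (fun τ => scd (Real.sqrt α * τ) k) T := by
  rw [h.T_eq_mul]
  exact (periodic_comp_mul (scd_periodic h.sq_lt) h.sqrt_pos.ne').nat_mul _

theorem cn_sq_periodic (hk : k ^ 2 < 1) :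
    Function.Periodic (fun u => cn u k ^ 2) (2 * ellipticK k) := fun u => by
  simp [cn_add hk]

theorem cos_sub_periodic (h : Resonance α k p q T) (τ₀ : ℝ) :
    Function.Periodic (fun τ => Real.cos (τ - τ₀)) T := fun τ => by
  simp only [h.T_eq]
  rw [show τ + 2 * Real.pi * q - τ₀ = τ - τ₀ + q * (2 * Real.pi) by ring,
    Real.cos_add_nat_mul_two_pi]

theorem cos_T (h : Resonance α k p q T) : Real.cos T = 1 := by
  rw [h.T_eq, show 2 * Real.pi * (q : ℝ) = 0 + q * (2 * Real.pi) by ring,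
    Real.cos_add_nat_mul_two_pi, Real.cos_zero]

theorem sin_T (h : Resonance α k p q T) : Real.sin T = 0 := by
  have := Real.sin_sq_add_cos_sq T
  rw [h.cos_T] at this
  nlinarith

theorem continuous_scd_comp (h : Resonance α k p q T) :
    Continuous fun τ => scd (Real.sqrt α * τ) k :=
  (continuous_scd h.sq_lt).comp (continuous_const.mul continuous_id)

theorem continuous_cn_comp (h : Resonance α k p q T) :
    Continuous fun τ => cn (Real.sqrt α * τ) k :=
  (continuous_cn h.sq_lt).comp (continuous_const.mul continuous_id)

theorem integral_cos_mul_scd (h : Resonance α k p q T) :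
    ∫ τ in (0 : ℝ)..T, Real.cos τ * scd (Real.sqrt α * τ) k = 0 := by
  refine integral_eq_zero_of_odd_of_periodic ?_ fun τ => ?_
  · have := (h.cos_sub_periodic 0).mul h.scd_comp_periodic
    simp only [sub_zero] at this
    exact this
  · rw [Real.cos_neg, mul_neg, scd_neg h.sq_lt, mul_neg]

theorem integral_sin_mul_scd (h : Resonance α k p q T) :
    ∫ τ in (0 : ℝ)..T, Real.sin τ * scd (Real.sqrt α * τ) k = T * G₁ α k T := by
  have := h.T_pos.ne'
  rw [G₁, average]
  field_simp
  exact intervalIntegral.integral_congr fun τ _ => by simp only [scd]; ring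

theorem integral_cos_sub_mul_scd (h : Resonance α k p q T) (τ₀ : ℝ) :
    ∫ τ in (0 : ℝ)..T, Real.cos (τ - τ₀) * scd (Real.sqrt α * τ) k
      = T * (Real.sin τ₀ * G₁ α k T) := by
  have hc := h.continuous_scd_comp
  have e : ∀ τ, Real.cos (τ - τ₀) * scd (Real.sqrt α * τ) k
      = Real.cos τ₀ * (Real.cos τ * scd (Real.sqrt α * τ) k)
        + Real.sin τ₀ * (Real.sin τ * scd (Real.sqrt α * τ) k) := fun τ => by
    rw [Real.cos_sub]
    ring
  simp only [e]
  rw [intervalIntegral.integral_add (Continuous.intervalIntegrable (by fun_prop) _ _)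
    (Continuous.intervalIntegrable (by fun_prop) _ _), intervalIntegral.integral_const_mul,
    intervalIntegral.integral_const_mul, h.integral_cos_mul_scd, h.integral_sin_mul_scd]
  ring

theorem integral_sin_sub_mul_scd (h : Resonance α k p q T) (τ₀ : ℝ) :
    ∫ τ in (0 : ℝ)..T, Real.sin (τ - τ₀) * scd (Real.sqrt α * τ) k
      = T * (Real.cos τ₀ * G₁ α k T) := by
  have hc := h.continuous_scd_comp
  have e : ∀ τ, Real.sin (τ - τ₀) * scd (Real.sqrt α * τ) k
      = Real.cos τ₀ * (Real.sin τ * scd (Real.sqrt α * τ) k)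
        - Real.sin τ₀ * (Real.cos τ * scd (Real.sqrt α * τ) k) := fun τ => by
    rw [Real.sin_sub]
    ring
  simp only [e]
  rw [intervalIntegral.integral_sub (Continuous.intervalIntegrable (by fun_prop) _ _)
    (Continuous.intervalIntegrable (by fun_prop) _ _), intervalIntegral.integral_const_mul,
    intervalIntegral.integral_const_mul, h.integral_cos_mul_scd, h.integral_sin_mul_scd]
  ring

/-- `T` consists of exactly `p` of the periods used in `Delta`, so the two means agree. -/
theorem integral_cn_sq (h : Resonance α k p q T) :
    ∫ τ in (0 : ℝ)..T, cn (Real.sqrt α * τ) k ^ 2 = T * Delta α k := by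
  have hs := h.sqrt_pos.ne'
  have hper : Function.Periodic (fun τ => cn (Real.sqrt α * τ) k ^ 2)
      (4 * ellipticK k / Real.sqrt α) := by
    have := (periodic_comp_mul (cn_sq_periodic h.sq_lt) hs).nat_mul 2
    rwa [show (2 : ℕ) * (2 * ellipticK k / Real.sqrt α) = 4 * ellipticK k / Real.sqrt α by
      push_cast; ring] at this
  have hT : T = p * (4 * ellipticK k / Real.sqrt α) := by
    rw [h.T_eq, h.res]
    ring
  have hK := h.K_pos.ne'
  have hp : (p : ℝ) ≠ 0 := by exact_mod_cast h.p_pos.ne'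
  have hint := integral_periodic_nat_mul hper (h.continuous_cn_comp.pow 2) p
  rw [← hT] at hint
  rw [hint, hT, Delta, average]
  field_simp

theorem Delta_pos (h : Resonance α k p q T) : 0 < Delta α k := by
  have hs := h.sqrt_pos
  have hK := h.K_pos
  have hint : 0 < ∫ τ in (0 : ℝ)..(4 * ellipticK k / Real.sqrt α),
      cn (Real.sqrt α * τ) k ^ 2 := by
    refine intervalIntegral.integral_pos (by positivity) (h.continuous_cn_comp.pow 2).continuousOn
      (fun _ _ => sq_nonneg _) ⟨0, ⟨le_rfl, by positivity⟩, ?_⟩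
    simp [cn, am_zero h.sq_lt]
  rw [Delta, average]
  positivity

theorem G₁_pos (h : Resonance α k p q T) {m : ℕ} (hm : 1 ≤ m) (hq : (p : ℝ) / q = 1 / (2 * m)) :
    0 < G₁ α k T := by
  have hk := h.sq_lt
  have hs := h.sqrt_pos
  set s := Real.sqrt α with hsdef
  have hK := h.K_pos
  have hp0 : (0 : ℝ) < p := by exact_mod_cast h.p_pos
  have hq0 : (0 : ℝ) < q := by exact_mod_cast h.q_pos
  have hm0 : (0 : ℝ) < m := by exact_mod_cast hm
  have hk0 := h.k_mem.1
  have hqm : (q : ℝ) = 2 * m * p := by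
    field_simp at hq
    linarith
  -- At this resonance the half-period `2K/√α` equals `2πm`, so `cos τ` is the `m`-th harmonic of
  -- `dn²(√α τ)`.
  have hKs : ellipticK k = Real.pi * m * s := by
    have hr := h.res
    rw [hqm, eq_div_iff hs.ne'] at hr
    have : (4 * p : ℝ) * (ellipticK k - Real.pi * m * s) = 0 := by linarith
    rcases mul_eq_zero.1 this with h1 | h1
    · linarith
    · linarith
  have hdnc : Continuous fun τ => dn (s * τ) k :=
    (continuous_dn hk).comp (continuous_const.mul continuous_id)
  have hscd := h.continuous_scd_comp
  -- Integration by parts, using `(dn²)' = -2k² sn cn dn`; the boundary terms vanish because `sin T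
  -- = 0`.
  have hparts : ∫ τ in (0 : ℝ)..T, ((-(2 * k ^ 2) * s) * (Real.sin τ * scd (s * τ) k)
      + dn (s * τ) k ^ 2 * Real.cos τ) = 0 := by
    have hd : ∀ τ, HasDerivAt (fun τ => dn (s * τ) k ^ 2 * Real.sin τ)
        ((-(2 * k ^ 2) * s) * (Real.sin τ * scd (s * τ) k) + dn (s * τ) k ^ 2 * Real.cos τ) τ :=
      fun τ => by
        have h1 : HasDerivAt (fun τ => dn (s * τ) k ^ 2)
            (-(2 * k ^ 2) * (sn (s * τ) k * cn (s * τ) k * dn (s * τ) k) * s) τ :=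
          HasDerivAt.comp (h₂ := fun u => dn u k ^ 2) τ (hasDerivAt_dn_sq hk (s * τ))
            (by simpa using (hasDerivAt_id τ).const_mul s)
        refine (h1.mul (Real.hasDerivAt_sin τ)).congr_deriv ?_
        rw [scd]
        ring
    rw [intervalIntegral.integral_eq_sub_of_hasDerivAt (fun τ _ => hd τ)
      (Continuous.intervalIntegrable (by fun_prop) _ _), h.sin_T, Real.sin_zero]
    ring
  rw [intervalIntegral.integral_add (Continuous.intervalIntegrable (by fun_prop) _ _)
    (Continuous.intervalIntegrable (by fun_prop) _ _), intervalIntegral.integral_const_mul,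
    h.integral_sin_mul_scd] at hparts
  have hP : 2 * ellipticK k / s = m * (2 * Real.pi) := by
    rw [hKs]
    field_simp
  have hper : Function.Periodic (fun τ => dn (s * τ) k ^ 2 * Real.cos τ)
      (2 * ellipticK k / s) := fun τ => by
    have e : s * (τ + 2 * ellipticK k / s) = s * τ + 2 * ellipticK k := by field_simp
    simp only [e, dn_add hk]
    rw [hP, Real.cos_add_nat_mul_two_pi]
  have hI : ∫ τ in (0 : ℝ)..T, dn (s * τ) k ^ 2 * Real.cos τ
      = (2 * p : ℕ) * (s⁻¹ * dnCoeff m k) := by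
    rw [h.T_eq_mul, integral_periodic_nat_mul hper (by fun_prop)]
    congr 1
    have h1 := intervalIntegral.integral_comp_mul_left (a := 0) (b := 2 * ellipticK k / s)
      (f := fun u => dn u k ^ 2 * Real.cos (m * Real.pi * u / ellipticK k)) hs.ne'
    rw [mul_zero, show s * (2 * ellipticK k / s) = 2 * ellipticK k by field_simp] at h1
    rw [smul_eq_mul] at h1
    rw [dnCoeff, ← h1]
    refine intervalIntegral.integral_congr fun τ _ => ?_
    have e : m * Real.pi * (s * τ) / ellipticK k = τ := by
      rw [hKs]
      field_simp
    simp only [e]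
  have hpos : 0 < ∫ τ in (0 : ℝ)..T, dn (s * τ) k ^ 2 * Real.cos τ := by
    rw [hI]
    have h1 := dnCoeff_pos h.k_mem hm
    push_cast
    positivity
  have hT := h.T_pos
  have hfin : 0 < 2 * k ^ 2 * s * T * G₁ α k T := by linarith
  exact pos_of_mul_pos_right hfin (by positivity)

/-- Shifting time by the half-period `P` fixes `sn cn dn` and the integral over `T`. Expanding `sin
(τ + P)` multiplies the same integral by `cos P`, since the cosine part is odd. Finally, `cos P = 1`
would force `P = 2πn`, that is `p/q = 1/(2n)`. -/
theorem G₁_eq_zero (h : Resonance α k p q T)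
    (hne : ∀ m : ℕ, 1 ≤ m → (p : ℝ) / q ≠ 1 / (2 * m)) : G₁ α k T = 0 := by
  have hs := h.sqrt_pos
  have hp0 : (0 : ℝ) < p := by exact_mod_cast h.p_pos
  have hq0 : (0 : ℝ) < q := by exact_mod_cast h.q_pos
  set P := 2 * ellipticK k / Real.sqrt α with hP
  have hPq : P * (2 * p) = 2 * Real.pi * q := by
    rw [h.res, hP]
    ring
  have hcos : Real.cos P ≠ 1 := by
    rw [Ne, Real.cos_eq_one_iff]
    rintro ⟨n, hn⟩
    have hPpos : 0 < P := by
      have := h.K_pos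
      positivity
    have hn0 : 0 < n := by
      have : (0 : ℝ) < n := by
        by_contra hcon
        have := mul_nonneg (sub_nonneg.2 (not_lt.1 hcon)) Real.two_pi_pos.le
        linarith
      exact_mod_cast this
    lift n to ℕ using hn0.le
    have hn1 : 1 ≤ n := by exact_mod_cast hn0
    refine hne n hn1 ?_
    have hn0' : (0 : ℝ) < n := by exact_mod_cast hn1
    rw [← hn] at hPq
    push_cast at hPq
    have : (2 * Real.pi) * (2 * n * p - q) = 0 := by linarith
    rcases mul_eq_zero.1 this with h1 | h1
    · linarith [Real.pi_pos]
    · field_simp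
      linarith
  have hg : Function.Periodic (fun τ => Real.sin τ * scd (Real.sqrt α * τ) k) T := fun τ => by
    have h1 := h.scd_comp_periodic τ
    simp only at h1
    simp only [h1, Real.sin_add, h.cos_T, h.sin_T]
    ring
  have hper : Function.Periodic (fun τ => scd (Real.sqrt α * τ) k) P :=
    periodic_comp_mul (scd_periodic h.sq_lt) hs.ne'
  have hshift : ∫ τ in (0 : ℝ)..T, Real.sin (τ + P) * scd (Real.sqrt α * τ) k
      = ∫ τ in (0 : ℝ)..T, Real.sin τ * scd (Real.sqrt α * τ) k := by
    have h1 := intervalIntegral.integral_comp_add_right (a := 0) (b := T)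
      (fun τ => Real.sin τ * scd (Real.sqrt α * τ) k) P
    rw [zero_add, add_comm T P, hg.intervalIntegral_add_eq P 0, zero_add] at h1
    rw [← h1]
    refine intervalIntegral.integral_congr fun τ _ => ?_
    have h2 := hper τ
    simp only at h2
    simp only [h2]
  have h3 := h.integral_sin_sub_mul_scd (-P)
  simp only [sub_neg_eq_add, Real.cos_neg] at h3
  rw [hshift, h.integral_sin_mul_scd] at h3
  have h4 : T * (1 - Real.cos P) * G₁ α k T = 0 := by linarith
  rcases mul_eq_zero.1 h4 with h5 | h5
  · rcases mul_eq_zero.1 h5 with h6 | h6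
    · exact absurd h6 h.T_pos.ne'
    · exact absurd (sub_eq_zero.1 h6).symm hcos
  · exact h5

theorem angle_unperturbed (h : Resonance α k p q T) (τ : ℝ) :
    2 * ellipticK k / Real.pi * (freq α (action α k) * τ) = Real.sqrt α * τ := by
  have := h.K_pos.ne'
  have := Real.pi_ne_zero
  rw [freq_action h.α_pos h.k_mem]
  field_simp

theorem F₂_one (h : Resonance α k p q T) (C₁ τ₀ : ℝ) {φ I : ℕ → ℝ → ℝ}
    (hu : IsUnperturbed α k φ I) (τ : ℝ) :
    F₂ α C₁ τ₀ φ I 1 τ = 8 * k ^ 2 * ellipticK k / Real.pi *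
      (Real.cos (τ - τ₀) * scd (Real.sqrt α * τ) k
        - C₁ * Real.sqrt α * cn (Real.sqrt α * τ) k ^ 2) := by
  rw [F₂, Nat.sub_self, orderCoeff_zero, hu.1, hu.2]
  simp only [actionField, modulus_action h.α_pos h.k_mem, h.angle_unperturbed, scd]
  ring

theorem average_F₂_one (h : Resonance α k p q T) (C₁ τ₀ : ℝ) {φ I : ℕ → ℝ → ℝ}
    (hu : IsUnperturbed α k φ I) :
    average T (F₂ α C₁ τ₀ φ I 1) = 8 * k ^ 2 * ellipticK k / Real.pi *
      (Real.sin τ₀ * G₁ α k T - C₁ * (Real.sqrt α * Delta α k)) := by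
  have hT := h.T_pos.ne'
  have hc := h.continuous_scd_comp
  have hc' := h.continuous_cn_comp
  rw [average, intervalIntegral.integral_congr (fun τ _ => h.F₂_one C₁ τ₀ hu τ),
    intervalIntegral.integral_const_mul,
    intervalIntegral.integral_sub (Continuous.intervalIntegrable (by fun_prop) _ _)
    (Continuous.intervalIntegrable (by fun_prop) _ _), intervalIntegral.integral_const_mul,
    h.integral_cos_sub_mul_scd, h.integral_cn_sq]
  field_simp

theorem average_F₂_one_eq_zero_iff (h : Resonance α k p q T) (C₁ τ₀ : ℝ) {φ I : ℕ → ℝ → ℝ}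
    (hu : IsUnperturbed α k φ I) :
    average T (F₂ α C₁ τ₀ φ I 1) = 0 ↔ C₁ = Real.sin τ₀ * threshold α k T := by
  have h1 : 8 * k ^ 2 * ellipticK k / Real.pi ≠ 0 := by
    have := h.K_pos
    have := h.k_mem.1
    have := Real.pi_pos
    positivity
  have h2 : Real.sqrt α * Delta α k ≠ 0 := (mul_pos h.sqrt_pos h.Delta_pos).ne'
  rw [h.average_F₂_one C₁ τ₀ hu, mul_eq_zero, or_iff_right h1, sub_eq_zero, threshold,
    mul_div_assoc', eq_div_iff h2, eq_comm]

theorem threshold_pos (h : Resonance α k p q T) {m : ℕ} (hm : 1 ≤ m)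
    (hq : (p : ℝ) / q = 1 / (2 * m)) : 0 < threshold α k T :=
  div_pos (h.G₁_pos hm hq) (mul_pos h.sqrt_pos h.Delta_pos)

end Resonance

theorem isUnperturbed_zeroth (α k : ℝ) : IsUnperturbed α k
    (fun n τ => if n = 0 then freq α (action α k) * τ else 0)
    (fun n _ => if n = 0 then action α k else 0) :=
  ⟨fun _ => rfl, fun _ => rfl⟩

/-- The derivative of the action field with respect to the angle, along the unperturbed motion. -/
theorem Resonance.exists_angle_deriv_actionField {α k T : ℝ} {p q : ℕ} (h : Resonance α k p q T)
    (C₁ τ₀ : ℝ) :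
    ∃ D : ℝ → ℝ, Continuous D ∧ (∀ τ, HasDerivAt (fun φ => actionField α C₁ τ₀ τ φ (action α k))
        (D τ) (freq α (action α k) * τ)) ∧
      ∫ τ in (0 : ℝ)..T, D τ = 8 * k ^ 2 * ellipticK k / Real.pi / freq α (action α k) *
        (T * (Real.cos τ₀ * G₁ α k T)) := by
  have hk := h.sq_lt
  have hs := h.sqrt_pos
  have hK := h.K_pos
  have hα := h.α_pos
  set s := Real.sqrt α with hsdef
  set c := 8 * k ^ 2 * ellipticK k / Real.pi with hcdef
  set Ω := freq α (action α k) with hΩdef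
  have hΩ : Ω = Real.pi * s / (2 * ellipticK k) := freq_action hα h.k_mem
  have hΩ0 : Ω ≠ 0 := by
    rw [hΩ]
    have := Real.pi_pos
    positivity
  have hsΩ : s = 2 * ellipticK k / Real.pi * Ω := by
    rw [hΩ]
    have := Real.pi_pos
    field_simp
  have hscd := h.continuous_scd_comp
  have hsn : Continuous fun τ => sn (s * τ) k :=
    (continuous_sn hk).comp (continuous_const.mul continuous_id)
  have hcn : Continuous fun τ => cn (s * τ) k := h.continuous_cn_comp
  have hdn : Continuous fun τ => dn (s * τ) k :=
    (continuous_dn hk).comp (continuous_const.mul continuous_id)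
  have hscdD : Continuous fun τ => scdDeriv (s * τ) k := by
    unfold scdDeriv
    fun_prop
  have hbase : ∀ (b u : ℝ), HasDerivAt (fun u => c * (b * scd u k - C₁ * s * cn u k ^ 2))
      (c * (b * scdDeriv u k - C₁ * s * (-(2 * cn u k * (sn u k * dn u k))))) u := fun b u => by
    refine ((((hasDerivAt_scd hk u).const_mul b).sub
      (((hasDerivAt_cn hk u).pow 2).const_mul (C₁ * s))).const_mul c).congr_deriv ?_
    push_cast
    ring
  let B : ℝ → ℝ := fun τ => c * (Real.cos (τ - τ₀) * scdDeriv (s * τ) k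
    - C₁ * s * (-(2 * cn (s * τ) k * (sn (s * τ) k * dn (s * τ) k))))
  have hB : Continuous B := by fun_prop
  refine ⟨fun τ => B τ * (2 * ellipticK k / Real.pi), by fun_prop, fun τ => ?_, ?_⟩
  · have e : (fun φ => actionField α C₁ τ₀ τ φ (action α k))
        = (fun u => c * (Real.cos (τ - τ₀) * scd u k - C₁ * s * cn u k ^ 2))
          ∘ (fun φ => 2 * ellipticK k / Real.pi * φ) := by
      funext φ
      simp only [actionField, modulus_action hα h.k_mem, scd, Function.comp, hcdef]
      ring
    rw [e]
    refine HasDerivAt.comp _ ?_ (by simpa using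
      (hasDerivAt_id (freq α (action α k) * τ)).const_mul (2 * ellipticK k / Real.pi))
    rw [h.angle_unperturbed]
    exact hbase _ _
  -- The total time derivative of `B` along the orbit is `Ω ∂B/∂φ + ∂B/∂τ`. It integrates to zero
  -- over a period, so the mean of `∂B/∂φ` follows from that of the explicit time derivative.
  · have hd : ∀ τ, HasDerivAt (fun τ => c * (Real.cos (τ - τ₀) * scd (s * τ) k
        - C₁ * s * cn (s * τ) k ^ 2))
        (Ω * (B τ * (2 * ellipticK k / Real.pi)) - c * (Real.sin (τ - τ₀) * scd (s * τ) k)) τ :=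
      fun τ => by
        have hlin : HasDerivAt (fun τ => s * τ) s τ := by simpa using (hasDerivAt_id τ).const_mul s
        have h1 := HasDerivAt.comp (h₂ := fun u => scd u k) τ (hasDerivAt_scd hk (s * τ)) hlin
        have h2 := HasDerivAt.comp (h₂ := fun u => cn u k) τ (hasDerivAt_cn hk (s * τ)) hlin
        have h3 : HasDerivAt (fun τ => Real.cos (τ - τ₀)) (-Real.sin (τ - τ₀)) τ := by
          simpa using ((hasDerivAt_id τ).sub_const τ₀).cos
        refine (((h3.mul h1).sub ((h2.pow 2).const_mul (C₁ * s))).const_mul c).congr_deriv ?_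
        have e : Ω * (B τ * (2 * ellipticK k / Real.pi)) = s * B τ := by
          linear_combination (-B τ) * hsΩ
        rw [e]
        simp only [B, Function.comp]
        push_cast
        ring
    have hint := intervalIntegral.integral_eq_sub_of_hasDerivAt (a := 0) (b := T)
      (fun τ _ => hd τ) (Continuous.intervalIntegrable (by fun_prop) _ _)
    have hper1 := h.scd_comp_periodic 0
    have hper2 := h.cos_sub_periodic τ₀ 0
    have hper3 : cn (s * (0 + T)) k ^ 2 = cn (s * 0) k ^ 2 := by
      have := ((periodic_comp_mul (Resonance.cn_sq_periodic hk) hs.ne').nat_mul (2 * p)) 0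
      rwa [← h.T_eq_mul] at this
    simp only [zero_add] at hper1 hper2 hper3
    rw [hper1, hper2, hper3, sub_self,
      intervalIntegral.integral_sub (Continuous.intervalIntegrable (by fun_prop) _ _)
      (Continuous.intervalIntegrable (by fun_prop) _ _), intervalIntegral.integral_const_mul,
      intervalIntegral.integral_const_mul, h.integral_sin_sub_mul_scd] at hint
    rw [div_mul_eq_mul_div, eq_div_iff hΩ0]
    linarith

end Averages

/-! ### Order-by-order construction of the periodic formal solution. -/

section FormalSolution

theorem hasDerivAt_primitive {f : ℝ → ℝ} (hf : Continuous f) (τ : ℝ) :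
    HasDerivAt (fun τ => ∫ x in (0 : ℝ)..τ, f x) (f τ) τ :=
  intervalIntegral.integral_hasDerivAt_right (hf.intervalIntegrable _ _)
    (hf.stronglyMeasurableAtFilter _ _) hf.continuousAt

theorem continuous_of_hasDerivAt {f f' : ℝ → ℝ} (hf : ∀ τ, HasDerivAt f (f' τ) τ) :
    Continuous f :=
  continuous_iff_continuousAt.2 fun τ => (hf τ).continuousAt

theorem periodic_primitive {f : ℝ → ℝ} {T : ℝ} (hf : Continuous f) (hper : Function.Periodic f T)
    (h0 : ∫ x in (0 : ℝ)..T, f x = 0) :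
    Function.Periodic (fun τ => ∫ x in (0 : ℝ)..τ, f x) T := fun τ => by
  have := hper.intervalIntegral_add_eq_add 0 τ fun a b => hf.intervalIntegrable a b
  simpa [h0] using this

theorem average_eq_zero_iff {T : ℝ} (hT : T ≠ 0) (g : ℝ → ℝ) :
    average T g = 0 ↔ ∫ τ in (0 : ℝ)..T, g τ = 0 := by
  rw [average, mul_eq_zero, or_iff_right (one_div_ne_zero hT)]

theorem F₂_congr (α C₁ τ₀ : ℝ) {φ I φ' I' : ℕ → ℝ → ℝ} {n : ℕ} (hn : 1 ≤ n)
    (h : ∀ j < n, φ' j = φ j) (h' : ∀ j < n, I' j = I j) :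
    F₂ α C₁ τ₀ φ' I' n = F₂ α C₁ τ₀ φ I n := by
  funext τ
  exact orderCoeff_congr _ (fun j hj => by rw [h j (by omega)])
    (fun j hj => by rw [h' j (by omega)])

namespace Resonance

variable {α k T : ℝ} {p q : ℕ}

theorem action_mem (h : Resonance α k p q T) : action α k ∈ action α '' Ioo 0 1 :=
  mem_image_of_mem _ h.k_mem

theorem contDiffAt_freq_sub (h : Resonance α k p q T) (x : ℝ) :
    ContDiffAt ℝ ∞ (fun x : ℝ × ℝ => freq α x.2 - freqDeriv α (action α k) * x.2)
      (x, action α k) := by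
  have h1 := (contDiffOn_freq h.α_pos).contDiffAt
    ((isOpen_image_action h.α_pos).mem_nhds h.action_mem)
  have h2 : ContDiffAt ℝ ∞ (fun x : ℝ × ℝ => freq α x.2) (x, action α k) :=
    ContDiffAt.comp (f := fun x : ℝ × ℝ => x.2) (x, action α k) h1 contDiffAt_snd
  exact h2.sub (contDiffAt_const.mul contDiffAt_snd)

/-- `orderCoeff n` formally involves `I⁽ⁿ⁾`, but only through the derivative of `Ω(J) - ζ⁽⁰⁾ J` at
the unperturbed action, which is zero. -/
theorem F₁_congr (h : Resonance α k p q T) (C₁ τ₀ : ℝ) {φ I φ' I' : ℕ → ℝ → ℝ} {n : ℕ}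
    (hn : 1 ≤ n) (hu : IsUnperturbed α k φ I)
    (hφ : ∀ j < n, φ' j = φ j) (hI : ∀ j < n, I' j = I j) :
    F₁ α C₁ τ₀ k φ' I' n = F₁ α C₁ τ₀ k φ I n := by
  funext τ
  have hI0 : I 0 τ = action α k := hu.2 τ
  have hd : HasFDerivAt (fun x : ℝ × ℝ => freq α x.2 - freqDeriv α (action α k) * x.2)
      (0 : ℝ × ℝ →L[ℝ] ℝ)
      (φ 0 τ, I 0 τ) := by
    have h1 : HasDerivAt (fun J => freq α J - freqDeriv α (action α k) * J) 0 (I 0 τ) := by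
      rw [hI0]
      refine ((hasDerivAt_freq h.α_pos h.k_mem).sub
        ((hasDerivAt_id (action α k)).const_mul (freqDeriv α (action α k)))).congr_deriv ?_
      ring
    have h2 := h1.hasFDerivAt.comp (φ 0 τ, I 0 τ) (hasFDerivAt_snd (𝕜 := ℝ))
    refine h2.congr_fderiv ?_
    ext <;> simp
  rw [F₁, F₁, orderCoeff_congr (angleField α C₁ τ₀ τ) (fun j hj => by rw [hφ j (by omega)])
    (fun j hj => by rw [hI j (by omega)])]
  congr 1
  rw [orderCoeff_top hn (g := fun _ J => freq α J - freqDeriv α (action α k) * J)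
    (φ := fun j => φ j τ) (I := fun j => I j τ) (by
      simp only [hI0]
      exact h.contDiffAt_freq_sub _) (fun j hj => by rw [hφ j hj]) (fun j hj => by rw [hI j hj]),
    hd.fderiv]
  simp

theorem continuous_F₂ (h : Resonance α k p q T) (C₁ τ₀ : ℝ) {φ I : ℕ → ℝ → ℝ} {n : ℕ}
    (hn : 1 ≤ n) (hu : IsUnperturbed α k φ I)
    (hφ : ∀ j < n, Continuous (φ j)) (hI : ∀ j < n, Continuous (I j)) :
    Continuous (F₂ α C₁ τ₀ φ I n) :=
  continuous_orderCoeff (n - 1) (isOpen_image_action h.α_pos)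
    (contDiffOn_actionField h.α_pos C₁ τ₀) (fun j hj => hφ j (by omega))
    (fun j hj => hI j (by omega)) fun τ => by rw [hu.2]; exact h.action_mem

theorem continuous_F₁ (h : Resonance α k p q T) (C₁ τ₀ : ℝ) {φ I : ℕ → ℝ → ℝ} {n : ℕ}
    (hu : IsUnperturbed α k φ I)
    (hφ : ∀ j ≤ n, Continuous (φ j)) (hI : ∀ j ≤ n, Continuous (I j)) :
    Continuous (F₁ α C₁ τ₀ k φ I n) := by
  have hmem : ∀ τ, I 0 τ ∈ action α '' Ioo 0 1 := fun τ => by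
    rw [hu.2]
    exact h.action_mem
  have h2 : ContDiffOn ℝ ∞
      (fun x : ℝ × ℝ × ℝ => freq α x.2.2 - freqDeriv α (action α k) * x.2.2)
      {x | x.2.2 ∈ action α '' Ioo 0 1} :=
    ((contDiffOn_freq h.α_pos).comp (f := fun x : ℝ × ℝ × ℝ => x.2.2) (by fun_prop)
      fun x hx => hx).sub (by fun_prop)
  exact (continuous_orderCoeff n (g := fun _ _ J => freq α J - freqDeriv α (action α k) * J)
    (isOpen_image_action h.α_pos) h2 hφ hI hmem).add
    (continuous_orderCoeff (n - 1) (isOpen_image_action h.α_pos)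
      (contDiffOn_angleField h.α_pos C₁ τ₀) (fun j hj => hφ j (by omega))
      (fun j hj => hI j (by omega)) hmem)

theorem angle_add_T (h : Resonance α k p q T) {φ I : ℕ → ℝ → ℝ} (hu : IsUnperturbed α k φ I)
    (τ : ℝ) : φ 0 (τ + T) = φ 0 τ + p * (2 * Real.pi) := by
  have := h.K_pos.ne'
  have := h.sqrt_pos.ne'
  rw [hu.1, hu.1, freq_action h.α_pos h.k_mem, h.T_eq, h.res]
  field_simp
  ring

theorem F₂_periodic (h : Resonance α k p q T) (C₁ τ₀ : ℝ) {φ I : ℕ → ℝ → ℝ} {n : ℕ}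
    (hn : 1 ≤ n) (hu : IsUnperturbed α k φ I)
    (hφ : ∀ j, 1 ≤ j → j < n → Function.Periodic (φ j) T)
    (hI : ∀ j, 1 ≤ j → j < n → Function.Periodic (I j) T) :
    Function.Periodic (F₂ α C₁ τ₀ φ I n) T := fun τ => by
  have hfield : actionField α C₁ τ₀ (τ + T) = actionField α C₁ τ₀ τ := by
    have := h.cos_sub_periodic τ₀ τ
    simp only at this
    funext x y
    simp only [actionField, this]
  rw [F₂, F₂, hfield]
  refine orderCoeff_shift (c := p * (2 * Real.pi)) ?_ (h.angle_add_T hu τ)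
    (fun j h1 hj => hφ j h1 (by omega) τ) fun j hj => ?_
  · rw [hu.2]
    filter_upwards [(isOpen_image_action h.α_pos).mem_nhds h.action_mem] with y hy
    exact (actionField_periodic h.α_pos C₁ τ₀ τ hy).nat_mul p
  · rcases Nat.eq_zero_or_pos j with rfl | h1
    · rw [hu.2, hu.2]
    · exact hI j h1 (by omega) τ

theorem F₁_periodic (h : Resonance α k p q T) (C₁ τ₀ : ℝ) {φ I : ℕ → ℝ → ℝ} {n : ℕ}
    (hu : IsUnperturbed α k φ I)
    (hφ : ∀ j, 1 ≤ j → j ≤ n → Function.Periodic (φ j) T)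
    (hI : ∀ j, 1 ≤ j → j ≤ n → Function.Periodic (I j) T) :
    Function.Periodic (F₁ α C₁ τ₀ k φ I n) T := fun τ => by
  have hfield : angleField α C₁ τ₀ (τ + T) = angleField α C₁ τ₀ τ := by
    have := h.cos_sub_periodic τ₀ τ
    simp only at this
    funext x y
    simp only [angleField, this]
  have hI' : ∀ j ≤ n, I j (τ + T) = I j τ := fun j hj => by
    rcases Nat.eq_zero_or_pos j with rfl | h1
    · rw [hu.2, hu.2]
    · exact hI j h1 hj τ
  rw [F₁, F₁, hfield]
  congr 1
  · refine orderCoeff_shift (c := p * (2 * Real.pi)) (.of_forall fun y x => rfl)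
      (h.angle_add_T hu τ) (fun j h1 hj => hφ j h1 hj τ) hI'
  · refine orderCoeff_shift (c := p * (2 * Real.pi)) ?_ (h.angle_add_T hu τ)
      (fun j h1 hj => hφ j h1 (by omega) τ) fun j hj => hI' j (by omega)
    rw [hu.2]
    filter_upwards [(isOpen_image_action h.α_pos).mem_nhds h.action_mem] with y hy
    exact (angleField_periodic h.α_pos C₁ τ₀ τ hy).nat_mul p

/-- Dependence of `F₂` on a constant added to the angle coefficient of the preceding order. -/
theorem F₂_succ_top (h : Resonance α k p q T) (C₁ τ₀ : ℝ) {φ I φ' : ℕ → ℝ → ℝ} {n : ℕ}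
    (hn : 1 ≤ n) (hu : IsUnperturbed α k φ I) {D : ℝ → ℝ}
    (hD : ∀ τ, HasDerivAt (fun φ => actionField α C₁ τ₀ τ φ (action α k)) (D τ)
      (freq α (action α k) * τ)) {b : ℝ}
    (hφ : ∀ j < n, φ' j = φ j) (hb : ∀ τ, φ' n τ = φ n τ + b) (τ : ℝ) :
    F₂ α C₁ τ₀ φ' I (n + 1) τ = F₂ α C₁ τ₀ φ I (n + 1) τ + b * D τ := by
  have h0 : ((φ 0 τ, I 0 τ) : ℝ × ℝ) = (freq α (action α k) * τ, action α k) := by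
    rw [hu.1, hu.2]
  have hO : IsOpen {x : ℝ × ℝ × ℝ | x.2.2 ∈ action α '' Ioo 0 1} :=
    (isOpen_image_action h.α_pos).preimage (by fun_prop)
  have hc : ContDiffAt ℝ ∞ (fun x : ℝ × ℝ => actionField α C₁ τ₀ τ x.1 x.2)
      (freq α (action α k) * τ, action α k) :=
    ContDiffAt.comp (f := fun x : ℝ × ℝ => (τ, x.1, x.2))
      (g := fun x : ℝ × ℝ × ℝ => actionField α C₁ τ₀ x.1 x.2.1 x.2.2) _
      ((contDiffOn_actionField h.α_pos C₁ τ₀).contDiffAt (hO.mem_nhds h.action_mem))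
      (by fun_prop)
  have hfd := (hc.differentiableAt (by simp)).hasFDerivAt
  have h1 : HasDerivAt (fun φ => (φ, action α k)) ((1 : ℝ), (0 : ℝ)) (freq α (action α k) * τ) :=
    (hasDerivAt_id _).prodMk (hasDerivAt_const _ _)
  have h2 := (HasFDerivAt.comp_hasDerivAt (f := fun φ => (φ, action α k)) _ hfd h1).unique (hD τ)
  rw [F₂, F₂, Nat.add_sub_cancel, orderCoeff_top hn (g := actionField α C₁ τ₀ τ)
    (φ := fun j => φ j τ) (I := fun j => I j τ) (by simp only [h0]; exact hc)
    (fun j hj => by rw [hφ j hj]) (fun j _ => rfl)]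
  congr 1
  rw [h0, hb, sub_self, add_sub_cancel_left,
    show ((b, 0) : ℝ × ℝ) = b • ((1 : ℝ), (0 : ℝ)) by simp, map_smul, h2, smul_eq_mul]

end Resonance

/-- The series solve the equations with periodic coefficients up to order `N`, and the average of
`F₂` vanishes up to order `N + 1`. -/
structure IsSolvedUpTo (α C₁ τ₀ k T : ℝ) (N : ℕ) (φ I : ℕ → ℝ → ℝ) : Prop where
  unperturbed : IsUnperturbed α k φ I
  angle_eq : ∀ n, 1 ≤ n → n ≤ N → ∀ τ,
    HasDerivAt (φ n) (freqDeriv α (action α k) * I n τ + F₁ α C₁ τ₀ k φ I n τ) τ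
  action_eq : ∀ n, 1 ≤ n → n ≤ N → ∀ τ, HasDerivAt (I n) (F₂ α C₁ τ₀ φ I n τ) τ
  angle_periodic : ∀ n, 1 ≤ n → n ≤ N → Function.Periodic (φ n) T
  action_periodic : ∀ n, 1 ≤ n → n ≤ N → Function.Periodic (I n) T
  average_eq : ∀ n, 1 ≤ n → n ≤ N + 1 → average T (F₂ α C₁ τ₀ φ I n) = 0

namespace IsSolvedUpTo

variable {α C₁ τ₀ k T : ℝ} {p q N : ℕ} {φ I : ℕ → ℝ → ℝ}

theorem continuous_angle (hs : IsSolvedUpTo α C₁ τ₀ k T N φ I) {j : ℕ} (hj : j ≤ N) :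
    Continuous (φ j) := by
  rcases Nat.eq_zero_or_pos j with rfl | h1
  · rw [show φ 0 = fun τ => freq α (action α k) * τ from funext hs.unperturbed.1]
    fun_prop
  · exact continuous_of_hasDerivAt (hs.angle_eq j h1 hj)

theorem continuous_action (hs : IsSolvedUpTo α C₁ τ₀ k T N φ I) {j : ℕ} (hj : j ≤ N) :
    Continuous (I j) := by
  rcases Nat.eq_zero_or_pos j with rfl | h1
  · rw [show I 0 = fun τ => action α k from funext hs.unperturbed.2]
    fun_prop
  · exact continuous_of_hasDerivAt (hs.action_eq j h1 hj)

theorem congr (h : Resonance α k p q T) (hs : IsSolvedUpTo α C₁ τ₀ k T N φ I)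
    {φ' I' : ℕ → ℝ → ℝ} (hφ : ∀ j ≤ N, φ' j = φ j) (hI : ∀ j ≤ N, I' j = I j) :
    IsSolvedUpTo α C₁ τ₀ k T N φ' I' where
  unperturbed := ⟨by rw [hφ 0 (by omega)]; exact hs.unperturbed.1,
    by rw [hI 0 (by omega)]; exact hs.unperturbed.2⟩
  angle_eq n h1 hn τ := by
    rw [hφ n hn, hI n hn, h.F₁_congr C₁ τ₀ h1 hs.unperturbed (fun j hj => hφ j (by omega))
      (fun j hj => hI j (by omega))]
    exact hs.angle_eq n h1 hn τ
  action_eq n h1 hn τ := by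
    rw [hI n hn, F₂_congr α C₁ τ₀ h1 (fun j hj => hφ j (by omega)) (fun j hj => hI j (by omega))]
    exact hs.action_eq n h1 hn τ
  angle_periodic n h1 hn := by
    rw [hφ n hn]
    exact hs.angle_periodic n h1 hn
  action_periodic n h1 hn := by
    rw [hI n hn]
    exact hs.action_periodic n h1 hn
  average_eq n h1 hn := by
    rw [F₂_congr α C₁ τ₀ h1 (fun j hj => hφ j (by omega)) (fun j hj => hI j (by omega))]
    exact hs.average_eq n h1 hn

/-- The average condition one order ahead makes the primitive of `F₂` periodic. The mean action is
then fixed by periodicity of the angle, and the initial angle by the average condition at the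
following order. -/
theorem exists_succ (h : Resonance α k p q T) (hs : IsSolvedUpTo α C₁ τ₀ k T N φ I)
    {D : ℝ → ℝ} (hDc : Continuous D)
    (hD : ∀ τ, HasDerivAt (fun φ => actionField α C₁ τ₀ τ φ (action α k)) (D τ)
      (freq α (action α k) * τ)) (hD0 : ∫ τ in (0 : ℝ)..T, D τ ≠ 0) :
    ∃ φ' I' : ℕ → ℝ → ℝ, (∀ j ≤ N, φ' j = φ j) ∧ (∀ j ≤ N, I' j = I j) ∧
      IsSolvedUpTo α C₁ τ₀ k T (N + 1) φ' I' := by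
  have hu := hs.unperturbed
  have hT := h.T_pos.ne'
  set ζ := freqDeriv α (action α k) with hζdef
  have hζ : ζ ≠ 0 := freqDeriv_ne_zero h.α_pos h.k_mem
  set n := N + 1 with hn
  have hn1 : 1 ≤ n := by omega
  have hupd : ∀ (a : ℕ → ℝ → ℝ) (x : ℝ → ℝ), ∀ j < n, Function.update a n x j = a j :=
    fun a x j hj => Function.update_of_ne (by omega) _ _
  have hupd0 : ∀ x y, IsUnperturbed α k (Function.update φ n x) (Function.update I n y) :=
    fun x y => ⟨by rw [hupd φ x 0 (by omega)]; exact hu.1,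
      by rw [hupd I y 0 (by omega)]; exact hu.2⟩
  -- the action coefficient up to a constant
  set f := F₂ α C₁ τ₀ φ I n with hf
  have hfc : Continuous f := h.continuous_F₂ C₁ τ₀ hn1 hu
    (fun j hj => hs.continuous_angle (by omega)) (fun j hj => hs.continuous_action (by omega))
  have hfp : Function.Periodic f T := h.F₂_periodic C₁ τ₀ hn1 hu
    (fun j h1 hj => hs.angle_periodic j h1 (by omega))
    (fun j h1 hj => hs.action_periodic j h1 (by omega))
  have hf0 : ∫ τ in (0 : ℝ)..T, f τ = 0 :=
    (average_eq_zero_iff hT _).1 (hs.average_eq n hn1 le_rfl)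
  set P : ℝ → ℝ := fun τ => ∫ x in (0 : ℝ)..τ, f x with hP
  have hPd : ∀ τ, HasDerivAt P (f τ) τ := hasDerivAt_primitive hfc
  have hPc : Continuous P := continuous_of_hasDerivAt hPd
  have hPp : Function.Periodic P T := periodic_primitive hfc hfp hf0
  -- the inhomogeneity of the angle equation
  set g := F₁ α C₁ τ₀ k (Function.update φ n 0) (Function.update I n 0) n with hg
  have hcont : ∀ a : ℕ → ℝ → ℝ, (∀ j ≤ N, Continuous (a j)) →
      ∀ j ≤ n, Continuous (Function.update a n 0 j) := fun a ha j hj => by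
    rcases hj.eq_or_lt with rfl | hlt
    · rw [Function.update_self]
      exact continuous_zero
    · rw [hupd a 0 j hlt]
      exact ha j (by omega)
  have hperiod : ∀ a : ℕ → ℝ → ℝ, (∀ j, 1 ≤ j → j ≤ N → Function.Periodic (a j) T) →
      ∀ j, 1 ≤ j → j ≤ n → Function.Periodic (Function.update a n 0 j) T := fun a ha j h1 hj => by
    rcases hj.eq_or_lt with rfl | hlt
    · rw [Function.update_self]
      exact fun _ => rfl
    · rw [hupd a 0 j hlt]
      exact ha j h1 (by omega)
  have hgc : Continuous g := h.continuous_F₁ C₁ τ₀ (hupd0 0 0)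
    (hcont φ fun j hj => hs.continuous_angle hj) (hcont I fun j hj => hs.continuous_action hj)
  have hgp : Function.Periodic g T := h.F₁_periodic C₁ τ₀ (hupd0 0 0)
    (hperiod φ hs.angle_periodic) (hperiod I hs.action_periodic)
  -- the choice of the mean action
  set c := -(∫ τ in (0 : ℝ)..T, (ζ * P τ + g τ)) / (ζ * T) with hc
  set J : ℝ → ℝ := fun τ => c + P τ with hJ
  set w : ℝ → ℝ := fun τ => ζ * J τ + g τ with hw
  have hwc : Continuous w := by fun_prop
  have hwp : Function.Periodic w T := fun τ => by simp only [hw, hJ, hPp τ, hgp τ]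
  have hw0 : ∫ τ in (0 : ℝ)..T, w τ = 0 := by
    have e : ∀ τ, w τ = ζ * c + (ζ * P τ + g τ) := fun τ => by
      simp only [hw, hJ]
      ring
    simp only [e]
    rw [intervalIntegral.integral_add intervalIntegrable_const
      (Continuous.intervalIntegrable (by fun_prop) _ _), intervalIntegral.integral_const,
      smul_eq_mul, hc]
    field_simp
    ring
  set Q : ℝ → ℝ := fun τ => ∫ x in (0 : ℝ)..τ, w x with hQ
  have hQd : ∀ τ, HasDerivAt Q (w τ) τ := hasDerivAt_primitive hwc
  have hQc : Continuous Q := continuous_of_hasDerivAt hQd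
  have hQp : Function.Periodic Q T := periodic_primitive hwc hwp hw0
  -- the choice of the initial angle
  set r := F₂ α C₁ τ₀ (Function.update φ n Q) (Function.update I n J) (n + 1) with hr
  have hrc : Continuous r := by
    refine h.continuous_F₂ C₁ τ₀ (by omega) (hupd0 _ _) (fun j hj => ?_) fun j hj => ?_
    · rcases (Nat.lt_succ_iff.1 hj).eq_or_lt with rfl | hlt
      · rwa [Function.update_self]
      · rw [hupd _ _ j hlt]
        exact hs.continuous_angle (by omega)
    · rcases (Nat.lt_succ_iff.1 hj).eq_or_lt with rfl | hlt
      · rw [Function.update_self]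
        fun_prop
      · rw [hupd _ _ j hlt]
        exact hs.continuous_action (by omega)
  set b := -(∫ τ in (0 : ℝ)..T, r τ) / ∫ τ in (0 : ℝ)..T, D τ with hb
  set φ' := Function.update φ n (fun τ => Q τ + b) with hφ'
  set I' := Function.update I n J with hI'
  have hφn : φ' n = fun τ => Q τ + b := Function.update_self _ _ _
  have hIn : I' n = J := Function.update_self _ _ _
  have hφlt : ∀ j < n, φ' j = φ j := hupd φ _
  have hIlt : ∀ j < n, I' j = I j := hupd I _
  have hF₁ : F₁ α C₁ τ₀ k φ' I' n = g :=
    h.F₁_congr C₁ τ₀ hn1 (hupd0 0 0) (fun j hj => by rw [hφlt j hj, hupd _ _ j hj])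
      (fun j hj => by rw [hIlt j hj, hupd _ _ j hj])
  have hF₂ : F₂ α C₁ τ₀ φ' I' n = f := F₂_congr α C₁ τ₀ hn1 hφlt hIlt
  -- The constant `b` enters the next order affinely with coefficient `D`, so its defining quotient
  -- cancels the mean of `r`.
  have hF₂' : ∀ τ, F₂ α C₁ τ₀ φ' I' (n + 1) τ = r τ + b * D τ :=
    h.F₂_succ_top C₁ τ₀ hn1 (hupd0 _ _) hD
      (fun j hj => by rw [hφlt j hj, hupd _ _ j hj])
      (fun τ => by rw [hφn, Function.update_self])
  have hold := hs.congr h (fun j hj => hφlt j (by omega)) (fun j hj => hIlt j (by omega))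
  refine ⟨φ', I', fun j hj => hφlt j (by omega), fun j hj => hIlt j (by omega), hupd0 _ _,
    fun m h1 hm τ => ?_, fun m h1 hm τ => ?_, fun m h1 hm => ?_, fun m h1 hm => ?_,
    fun m h1 hm => ?_⟩
  · rcases hm.eq_or_lt with rfl | hlt
    · rw [hF₁, hφn, hIn]
      exact (hQd τ).add_const b
    · exact hold.angle_eq m h1 (by omega) τ
  · rcases hm.eq_or_lt with rfl | hlt
    · rw [hF₂, hIn]
      exact (hPd τ).const_add c
    · exact hold.action_eq m h1 (by omega) τ
  · rcases hm.eq_or_lt with rfl | hlt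
    · rw [hφn]
      exact fun τ => by simp only [hQp τ]
    · exact hold.angle_periodic m h1 (by omega)
  · rcases hm.eq_or_lt with rfl | hlt
    · rw [hIn]
      exact fun τ => by simp only [hJ, hPp τ]
    · exact hold.action_periodic m h1 (by omega)
  · rcases hm.eq_or_lt with rfl | hlt
    · rw [average_eq_zero_iff hT, intervalIntegral.integral_congr (fun τ _ => hF₂' τ),
        intervalIntegral.integral_add (hrc.intervalIntegrable _ _)
        ((hDc.const_mul b).intervalIntegrable _ _), intervalIntegral.integral_const_mul, hb,
        div_mul_cancel₀ _ hD0]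
      ring
    · exact hold.average_eq m h1 (by omega)

end IsSolvedUpTo

theorem Resonance.exists_formalSolution {α k T C₁ τ₀ : ℝ} {p q : ℕ} (h : Resonance α k p q T)
    (hC : C₁ = Real.sin τ₀ * threshold α k T) (hG : G₁ α k T ≠ 0) (hcos : Real.cos τ₀ ≠ 0) :
    ∃ φ I : ℕ → ℝ → ℝ, ∀ N, IsSolvedUpTo α C₁ τ₀ k T N φ I := by
  obtain ⟨D, hDc, hD, hDint⟩ := h.exists_angle_deriv_actionField C₁ τ₀
  have hD0 : ∫ τ in (0 : ℝ)..T, D τ ≠ 0 := by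
    have h1 := h.K_pos.ne'
    have h2 := h.k_mem.1.ne'
    have h3 := Real.pi_ne_zero
    have h4 := h.T_pos.ne'
    have h5 : freq α (action α k) ≠ 0 := by
      rw [freq_action h.α_pos h.k_mem]
      have := h.sqrt_pos.ne'
      positivity
    rw [hDint]
    positivity
  have hbase : IsSolvedUpTo α C₁ τ₀ k T 0
      (fun n τ => if n = 0 then freq α (action α k) * τ else 0)
      (fun n _ => if n = 0 then action α k else 0) := by
    have hu := isUnperturbed_zeroth α k
    refine ⟨hu, fun n h1 hn => by omega, fun n h1 hn => by omega, fun n h1 hn => by omega,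
      fun n h1 hn => by omega, fun n h1 hn => ?_⟩
    obtain rfl : n = 1 := by omega
    exact (h.average_F₂_one_eq_zero_iff C₁ τ₀ hu).2 hC
  -- Each extension leaves earlier orders unchanged, so coefficient `n` is final from stage `n` on.
  -- The diagonal of the stages is then a solution to all orders.
  choose! a b ha hb hab using fun (N : ℕ) (x : (ℕ → ℝ → ℝ) × (ℕ → ℝ → ℝ))
    (hx : IsSolvedUpTo α C₁ τ₀ k T N x.1 x.2) => hx.exists_succ h hDc hD hD0
  let s : ℕ → (ℕ → ℝ → ℝ) × (ℕ → ℝ → ℝ) := fun N => Nat.rec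
    (fun n τ => if n = 0 then freq α (action α k) * τ else 0,
      fun n _ => if n = 0 then action α k else 0) (fun N x => (a N x, b N x)) N
  have hs : ∀ N, IsSolvedUpTo α C₁ τ₀ k T N (s N).1 (s N).2 := fun N => by
    induction N with
    | zero => exact hbase
    | succ N ih => exact hab N (s N) ih
  have hstable : ∀ j d, (s (j + d)).1 j = (s j).1 j ∧ (s (j + d)).2 j = (s j).2 j := fun j d => by
    induction d with
    | zero => exact ⟨rfl, rfl⟩
    | succ d ih =>
      rw [← ih.1, ← ih.2]
      exact ⟨ha (j + d) (s (j + d)) (hs _) j (by omega), hb (j + d) (s (j + d)) (hs _) j (by omega)⟩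
  refine ⟨fun n => (s n).1 n, fun n => (s n).2 n, fun N => (hs N).congr h (fun j hj => ?_)
    fun j hj => ?_⟩
  · obtain ⟨d, rfl⟩ := Nat.exists_eq_add_of_le hj
    exact (hstable j d).1.symm
  · obtain ⟨d, rfl⟩ := Nat.exists_eq_add_of_le hj
    exact (hstable j d).2.symm

end FormalSolution

end Pendulum

end

/-! ### Assembly of the lemma. -/

theorem lemma1 (α k : ℝ) (hα : 0 < α) (hk0 : 0 < k) (hk1 : k < 1)
    (p q : ℕ) (hp : 0 < p) (hq : 0 < q) (T : ℝ) (hT : T = 2 * Real.pi * q)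
    (hres : 2 * Real.pi * q = 4 * Pendulum.ellipticK k * p / Real.sqrt α) :
    ((∃ m : ℕ, 1 ≤ m ∧ (p : ℝ) / q = 1 / (2 * m)) →
      0 < Pendulum.threshold α k T ∧
      (∀ C₁ : ℝ,
        (∃ (τ₀ : ℝ) (φ I : ℕ → ℝ → ℝ), Pendulum.IsUnperturbed α k φ I ∧
          Pendulum.average T (Pendulum.F₂ α C₁ τ₀ φ I 1) = 0) ↔
        |C₁| ≤ Pendulum.threshold α k T) ∧
      (∀ C₁ : ℝ, |C₁| < Pendulum.threshold α k T →
        ∃ (τ₀ : ℝ) (φbar Ibar : ℕ → ℝ) (φ I : ℕ → ℝ → ℝ),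
          Pendulum.IsFormalSolution α C₁ τ₀ k φbar Ibar φ I ∧
          ∀ n : ℕ, 1 ≤ n →
            Pendulum.average T (Pendulum.F₂ α C₁ τ₀ φ I n) = 0 ∧
            Function.Periodic (φ n) T ∧ Function.Periodic (I n) T)) ∧
    ((∀ m : ℕ, 1 ≤ m → (p : ℝ) / q ≠ 1 / (2 * m)) →
      ∀ (C₁ τ₀ : ℝ) (φ I : ℕ → ℝ → ℝ), Pendulum.IsUnperturbed α k φ I →
        Pendulum.average T (Pendulum.F₂ α C₁ τ₀ φ I 1) = 0 → C₁ = 0) := by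
  have h : Pendulum.Resonance α k p q T := ⟨hα, ⟨hk0, hk1⟩, hp, hq, hT, hres⟩
  refine ⟨fun ⟨m, hm, hpq⟩ => ?_, fun hne C₁ τ₀ φ I hu h0 => ?_⟩
  · have hthr := h.threshold_pos hm hpq
    refine ⟨hthr, fun C₁ => ⟨?_, fun hC => ?_⟩, fun C₁ hC => ?_⟩
    · rintro ⟨τ₀, φ, I, hu, h0⟩
      rw [(h.average_F₂_one_eq_zero_iff C₁ τ₀ hu).1 h0, abs_mul, abs_of_pos hthr]
      exact mul_le_of_le_one_left hthr.le (Real.abs_sin_le_one τ₀)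
    · rw [abs_le] at hC
      refine ⟨Real.arcsin (C₁ / Pendulum.threshold α k T), _, _,
        Pendulum.isUnperturbed_zeroth α k,
        (h.average_F₂_one_eq_zero_iff C₁ _ (Pendulum.isUnperturbed_zeroth α k)).2 ?_⟩
      rw [Real.sin_arcsin (by rw [le_div_iff₀ hthr]; linarith)
        (by rw [div_le_one hthr]; exact hC.2), div_mul_cancel₀ _ hthr.ne']
    · rw [abs_lt] at hC
      have h1 : -1 < C₁ / Pendulum.threshold α k T := by rw [lt_div_iff₀ hthr]; linarith
      have h2 : C₁ / Pendulum.threshold α k T < 1 := by rw [div_lt_one hthr]; exact hC.2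
      have hsin := Real.sin_arcsin h1.le h2.le
      -- The strict inequality is used here: at `|C₁| = threshold` the phase is `±π/2` and the
      -- cosine vanishes.
      have hcos : Real.cos (Real.arcsin (C₁ / Pendulum.threshold α k T)) ≠ 0 :=
        (Real.cos_pos_of_mem_Ioo ⟨Real.neg_pi_div_two_lt_arcsin.2 h1,
          Real.arcsin_lt_pi_div_two.2 h2⟩).ne'
      obtain ⟨φ, I, hs⟩ := h.exists_formalSolution
        (C₁ := C₁) (by rw [hsin, div_mul_cancel₀ _ hthr.ne']) (h.G₁_pos hm hpq).ne' hcos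
      -- The initial conditions are read off from the constructed coefficients.
      exact ⟨_, fun n => φ n 0, fun n => I n 0, φ, I,
        ⟨(hs 0).unperturbed, fun _ _ => rfl, fun _ _ => rfl,
          fun n hn => (hs n).angle_eq n hn le_rfl, fun n hn => (hs n).action_eq n hn le_rfl⟩,
        fun n hn => ⟨(hs n).average_eq n hn (by omega), (hs n).angle_periodic n hn le_rfl,
          (hs n).action_periodic n hn le_rfl⟩⟩
  · rw [(h.average_F₂_one_eq_zero_iff C₁ τ₀ hu).1 h0, Pendulum.threshold, h.G₁_eq_zero hne]
    simp
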